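/- Let $\lambda,\lambda_0\ge 0$ and, for $x\in\mathbb Z$, let $e_x=\langle x,x+1\rangle$ be the edges of $\mathbb Z$. Attach to each edge $e_x$ five Poisson processes of marks on $[0,\infty)$, all of them independent: left-arrows and right-arrows for right particles and left-arrows and right-arrows for left particles, each of rate $1/2$, and nucleations, of rate $\lambda$ if $x\ne0$ and of rate $\lambda+\lambda_0$ if $x=0$. The randomized poly-nuclear growth (RPNG) process is the height process $h_t^{\lambda_0}(e_x)\in\mathbb Z$, with $h_0^{\lambda_0}\equiv0$, which these marks drive as follows. If a profile $h$ satisfies $h(e_{x-1})>h(e_x)$, we say that the site $x$ holds $h(e_{x-1})-h(e_x)$ right particles (right ends of plateaux); if $h(e_x)>h(e_{x-1})$, it holds $h(e_x)-h(e_{x-1})$ left particles (left ends of plateaux). A nucleation on $e_x$ increases $h(e_x)$ by $1$. An arrow on $e_x$ has an effect only if its source (the site $x+1$ for a left-arrow, $x$ for a right-arrow) holds at least one particle of the type of the arrow; one such particle then crosses $e_x$, that is, $h(e_x)$ increases by $1$ if a right particle moves to the right or a left particle moves to the left, and decreases by $1$ in the two opposite cases. (Almost surely, for each $t$ there are edges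 without marks in $[0,t]$ arbitrarily far to the left and to the right, so that between them only finitely many marks act, in chronological order; equivalently, $h_t^{\lambda_0}(e_x)$ is the eventual value, as $n\to\infty$, of the height obtained by using only the marks on the edges $e_y$ with $|y|\le n$.) Then for all $\lambda,\lambda_0\ge0$, almost surely, $$\lim_{t\to\infty}\frac{h_t^{\lambda_0}(e_0)}{t}=\lambda+\max\{\lambda_0-1,0\},$$ and for every $x\neq 0$, almost surely, $$\lim_{t\to\infty}\frac{h_t^{\lambda_0}(e_x)}{t}=\lambda .$$ Consequently, writing $v(\lambda,\lambda_0)$ for the almost sure limit of $h_t^{\lambda_0}(e_0)/t$, the critical defect strength $$\lambda_c(\lambda):=\inf\{\lambda_0\ge 0: v(\lambda,\lambda_0)>v(\lambda,0)\}$$ equals $1$ for every $\lambda\ge0$. -/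

import Mathlib

open MeasureTheory ProbabilityTheory Filter Topology
open scoped NNReal

noncomputable section

namespace RPNG

/-! ### Poisson processes -/

/-- `N` is the counting process of a homogeneous Poisson process of intensity `r` on `[0, ∞)`:
it starts at `0`, has independent Poisson distributed increments, and almost every path is a
nondecreasing right-continuous step function. -/
structure IsPoissonProcess {Ω : Type*} [MeasurableSpace Ω] (P : Measure Ω) (r : ℝ≥0)
    (N : ℝ≥0 → Ω → ℕ) : Prop where
  measurable : ∀ t, Measurable (N t)
  zero : ∀ᵐ ω ∂P, N 0 ω = 0
  monotone : ∀ᵐ ω ∂P, Monotone fun t => N t ω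
  rightCts : ∀ᵐ ω ∂P, ∀ t, ContinuousWithinAt (fun s => N s ω) (Set.Ici t) t
  indep : HasIndepIncrements N P
  law : ∀ s t, s ≤ t → HasLaw (fun ω => N t ω - N s ω) (poissonMeasure (r * (t - s))) P

/-- The points (times of the marks) of a counting path: the times at which it jumps. -/
def jumpTimes (N : ℝ≥0 → ℕ) : Set ℝ≥0 := {s | 0 < s ∧ ∀ u < s, N u < N s}

/-! ### The graphical representation

The integer `x` stands both for the site `x` and for the edge `e_x = ⟨x, x + 1⟩`. -/

/-- The kinds of marks an edge can carry. `leftR`, `leftL` are arrows to the left for right and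
left particles, `rightR`, `rightL` are arrows to the right for right and left particles,
and `nuc` is a nucleation. -/
inductive Kind
  | leftR
  | leftL
  | rightR
  | rightL
  | nuc
  deriving DecidableEq

instance : Fintype Kind :=
  ⟨{.leftR, .leftL, .rightR, .rightL, .nuc}, by intro k; cases k <;> decide⟩

/-- Intensity of the marks of each kind on the edge `e_x`: every kind of arrow has rate `1/2`;
nucleations have rate `lam`, except on `e_0` where they have rate `lam + lam0`. -/
def rate (lam lam0 : ℝ≥0) : Kind → ℤ → ℝ≥0
  | .nuc, x => if x = 0 then lam + lam0 else lam
  | _, _ => 1 / 2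

/-- A Harris system: mutually independent Poisson processes, one for each kind of mark and each
edge, with the intensities given by `rate`. -/
structure IsHarrisSystem {Ω : Type*} [MeasurableSpace Ω] (P : Measure Ω) (lam lam0 : ℝ≥0)
    (N : Kind × ℤ → ℝ≥0 → Ω → ℕ) : Prop where
  poisson : ∀ c, IsPoissonProcess P (rate lam lam0 c.1 c.2) (N c)
  indep : iIndepFun (fun c ω t => N c t ω) P

/-! ### The dynamics

A height profile is a function `η : ℤ → ℤ`, where `η x` is the number of layers above `e_x`. -/

/-- Number of left particles (left ends of plateaux) at the site `x`. -/
def numLeft (η : ℤ → ℤ) (x : ℤ) : ℕ := (η x - η (x - 1)).toNat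

/-- Number of right particles (right ends of plateaux) at the site `x`. -/
def numRight (η : ℤ → ℤ) (x : ℤ) : ℕ := (η (x - 1) - η x).toNat

/-- Change of the height above `e_x = ⟨x, x + 1⟩` caused by a mark of the given kind on `e_x`, when
the profile just before is `η`. An arrow acts only if its source site holds a particle of the
right type, which then crosses `e_x`: a right particle crossing to the right, or a left particle
crossing to the left, extends a plateau over `e_x`, and the opposite crossings uncover `e_x`. -/
def effect (η : ℤ → ℤ) (x : ℤ) : Kind → ℤ
  | .leftR => if 0 < numRight η (x + 1) then -1 else 0
  | .leftL => if 0 < numLeft η (x + 1) then 1 else 0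
  | .rightR => if 0 < numRight η x then 1 else 0
  | .rightL => if 0 < numLeft η x then -1 else 0
  | .nuc => 1

open Classical in
/-- Action on the profile `η` of the marks of `M` that occur at time `s` on the edges `e_x` with
`|x| ≤ n` (almost surely there is at most one mark at any given time). -/
def step (M : Kind → ℤ → Set ℝ≥0) (n : ℕ) (s : ℝ≥0) (η : ℤ → ℤ) : ℤ → ℤ := fun x =>
  η x + ∑ k : Kind, if |x| ≤ (n : ℤ) ∧ s ∈ M k x then effect η x k else 0

/-- The times in `(0, t]` of the marks on the edges `e_x` with `|x| ≤ n`. -/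
def boxTimes (M : Kind → ℤ → Set ℝ≥0) (n : ℕ) (t : ℝ≥0) : Set ℝ≥0 :=
  {s | 0 < s ∧ s ≤ t ∧ ∃ k x, |x| ≤ (n : ℤ) ∧ s ∈ M k x}

open Classical in
/-- The height profile at time `t`, started from the flat profile, when only the marks on the edges
`e_x` with `|x| ≤ n` are used: these marks act one after the other in chronological order. -/
def boxHeight (M : Kind → ℤ → Set ℝ≥0) (n : ℕ) (t : ℝ≥0) : ℤ → ℤ :=
  if h : (boxTimes M n t).Finite then
    (h.toFinset.sort (· ≤ ·)).foldl (fun η s => step M n s η) 0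
  else 0

/-- The height above `e_x` at time `t` in the environment of marks `M`. Almost surely there are
edges without marks before time `t` on both sides of `e_x`, so `boxHeight M n t x` does not depend
on `n` once `n` is large; the height is this eventual value. -/
def markHeight (M : Kind → ℤ → Set ℝ≥0) (t : ℝ≥0) (x : ℤ) : ℤ :=
  limUnder atTop fun n : ℕ => boxHeight M n t x

/-- The height process `h_t(e_x)` driven by the Harris system `N`. -/
def height {Ω : Type*} (N : Kind × ℤ → ℝ≥0 → Ω → ℕ) (x : ℤ) (t : ℝ≥0) (ω : Ω) : ℤ :=
  markHeight (fun k y => jumpTimes fun s => N (k, y) s ω) t x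

/-! ### Speed and critical strength of the defect -/

/-- Almost surely `h_t / t → v` as `t → ∞`. -/
def HasSpeed {Ω : Type*} [MeasurableSpace Ω] (P : Measure Ω) (h : ℝ≥0 → Ω → ℤ) (v : ℝ) : Prop :=
  ∀ᵐ ω ∂P, Tendsto (fun t : ℝ≥0 => (h t ω : ℝ) / (t : ℝ)) atTop (𝓝 v)

/-- The critical strength: for a family of processes `h lam0` indexed by the strength `lam0` of the
defect, the infimum of the strengths at which the speed is strictly larger than at strength `0`. -/
def criticalStrength {Ω : ℝ≥0 → Type*} [∀ lam0, MeasurableSpace (Ω lam0)]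
    (P : ∀ lam0, Measure (Ω lam0)) (h : ∀ lam0, ℝ≥0 → Ω lam0 → ℤ) : ℝ≥0 :=
  sInf {lam0 | ∃ v₀ v : ℝ, HasSpeed (P 0) (h 0) v₀ ∧ HasSpeed (P lam0) (h lam0) v ∧ v₀ < v}

end RPNG

end

noncomputable section

namespace RPNG

/-! ### Evolution of the box heights -/

/-! Write `σ = ±1` and bound `σ h` from above: `σ = 1` gives upper bounds on the height and `σ = -1`
lower bounds. Turning the picture upside down exchanges left and right particles and makes
nucleations lower the profile, so one argument serves both signs.

Away from the defect, place an edge in a block of `L` consecutive edges avoiding `e_0`, and put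
infinitely high walls at both ends. This can only raise `σ h` on the block (`effect_le_wallEffect`),
and the block no longer feels the defect. In the wall system `g` consider `W = ∑ exp (θ g_i)`.
Neighbouring heights attract each other, so to first order in `θ` the arrows contribute the two end
weights minus the total variation of the weights `exp (θ g_i)`. This is at most twice the smallest
weight, hence at most `2 W / L` (`sum_sign_le`). So the mean of `W` grows at an exponential rate at
most `θ (σ λ + 1 / L) + O(θ²)`, and `σ h` has speed at most `σ λ + 1 / L`
(`IsHarrisSystem.ae_walk_le`). Letting `L → ∞`, with both signs, gives speed `λ` off the defect.

At `e_0`, as long as `σ h(e_0)` exceeds both neighbours, its change is prescribed by three mark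
counts, with drift `σ (λ + λ₀) - 1`. Going back to the last time this failed, when `e_0` was no
higher than a neighbour, bounds its speed by `max (σ λ) (σ (λ + λ₀) - 1)` (`boxHeight_zero_le`).
Conversely only two kinds of arrows, of total rate `1`, can ever lower `e_0`, so its speed is at
least `λ + λ₀ - 1` (`peakCount_le_boxHeight`).

These comparisons are deterministic and take place in finite boxes, with constants independent of
the box. Edges without marks carry them over to the infinite system. -/

lemma sort_insert_of_lt {α : Type*} [LinearOrder α] {s : Finset α} {a : α} (h : ∀ b ∈ s, b < a) :
    (insert a s).sort (· ≤ ·) = s.sort (· ≤ ·) ++ [a] := by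
  have ha : a ∉ s := fun ha => (h a ha).false
  refine List.Perm.eq_of_pairwise' (r := (· ≤ ·)) (Finset.pairwise_sort _ _) ?_ ?_
  · rw [List.pairwise_append]
    refine ⟨Finset.pairwise_sort _ _, by simp, ?_⟩
    intro x hx y hy
    simp only [List.mem_singleton] at hy
    subst hy
    exact (h x (by simpa using hx)).le
  · refine (List.perm_ext_iff_of_nodup (Finset.sort_nodup _ _) ?_).2 ?_
    · rw [List.nodup_append]
      refine ⟨Finset.sort_nodup _ _, by simp, ?_⟩
      intro x hx y hy
      simp only [List.mem_singleton] at hy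
      subst hy
      exact (h x (by simpa using hx)).ne
    · intro x
      simp [or_comm]

/-- No mark on the edges of the box of radius `n` occurs strictly between `s` and `t`. -/
def Quiet (M : Kind → ℤ → Set ℝ≥0) (n : ℕ) (s t : ℝ≥0) : Prop :=
  ∀ u, s < u → u < t → ∀ k x, |x| ≤ (n : ℤ) → u ∉ M k x

section Deterministic

variable {M : Kind → ℤ → Set ℝ≥0} {n : ℕ}

lemma boxTimes_mono {s t : ℝ≥0} (h : s ≤ t) : boxTimes M n s ⊆ boxTimes M n t :=
  fun _ hu => ⟨hu.1, hu.2.1.trans h, hu.2.2⟩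

lemma boxHeight_zero : boxHeight M n 0 = 0 := by
  have h : boxTimes M n 0 = ∅ := by
    ext u
    simp only [boxTimes, Set.mem_ofPred_eq, Set.mem_empty_iff_false, iff_false]
    rintro ⟨h1, h2, -⟩
    exact (h1.trans_le h2).false
  unfold boxHeight
  simp [h]

/-- The time `t` need not carry a mark: without one, `step` is the identity. Inductions can
therefore use any two times with a quiet gap between them. -/
lemma boxHeight_eq_step {s t : ℝ≥0} (hfin : (boxTimes M n t).Finite) (hst : s < t)
    (hq : Quiet M n s t) : boxHeight M n t = step M n t (boxHeight M n s) := by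
  classical
  have hfs : (boxTimes M n s).Finite := hfin.subset (boxTimes_mono hst.le)
  have key : ∀ u ∈ boxTimes M n t, u ∈ boxTimes M n s ∨ u = t := by
    rintro u ⟨h1, h2, k, x, hx, hu⟩
    by_cases hus : u ≤ s
    · exact Or.inl ⟨h1, hus, k, x, hx, hu⟩
    · rcases h2.lt_or_eq with h | h
      · exact absurd hu (hq u (not_le.1 hus) h k x hx)
      · exact Or.inr h
  by_cases ht : t ∈ boxTimes M n t
  · have hins : hfin.toFinset = insert t hfs.toFinset := by
      ext u
      simp only [Set.Finite.mem_toFinset, Finset.mem_insert]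
      constructor
      · intro hu; exact (key u hu).symm
      · rintro (rfl | hu)
        · exact ht
        · exact boxTimes_mono hst.le hu
    unfold boxHeight
    rw [dif_pos hfin, dif_pos hfs, hins, sort_insert_of_lt, List.foldl_append]
    · rfl
    · intro b hb
      rw [Set.Finite.mem_toFinset] at hb
      exact hb.2.1.trans_lt hst
  · have heq : boxTimes M n t = boxTimes M n s := by
      refine Set.Subset.antisymm (fun u hu => ?_) (boxTimes_mono hst.le)
      rcases key u hu with h | rfl
      · exact h
      · exact absurd hu ht
    have hb : boxHeight M n t = boxHeight M n s := by
      unfold boxHeight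
      simp only [heq]
    rw [hb]
    funext x
    unfold step
    rw [Finset.sum_eq_zero, add_zero]
    intro k _
    rw [if_neg]
    rintro ⟨hx, hk⟩
    exact ht ⟨hst.bot_lt, le_rfl, k, x, hx, hk⟩

/-- Induction along the marks of a box. -/
lemma mark_induction (hfin : ∀ t, (boxTimes M n t).Finite) {s₀ : ℝ≥0} {Q : ℝ≥0 → Prop}
    (h0 : Q s₀) (hstep : ∀ s t, s₀ ≤ s → s < t → Quiet M n s t → Q s → Q t) :
    ∀ t, s₀ ≤ t → Q t := by
  classical
  have main : ∀ m : ℕ, ∀ t, s₀ ≤ t → (boxTimes M n t ∩ Set.Ioo s₀ t).ncard = m → Q t := by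
    intro m
    induction m using Nat.strong_induction_on with
    | _ m ih =>
      intro t hst hm
      have hf : (boxTimes M n t ∩ Set.Ioo s₀ t).Finite := (hfin t).subset Set.inter_subset_left
      rcases hst.eq_or_lt with rfl | hlt
      · exact h0
      rcases Set.eq_empty_or_nonempty (boxTimes M n t ∩ Set.Ioo s₀ t) with he | hne
      · refine hstep s₀ t le_rfl hlt (fun u h1 h2 k x hx hu => ?_) h0
        have : u ∈ boxTimes M n t ∩ Set.Ioo s₀ t := ⟨⟨h1.bot_lt, h2.le, k, x, hx, hu⟩, h1, h2⟩
        rw [he] at this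
        exact this
      -- Here `s` is the last mark before `t`, so the gap up to `t` is quiet and fewer marks precede
      -- `s`.
      · obtain ⟨s, hs, hmax⟩ := hf.exists_maximal hne
        refine hstep s t hs.2.1.le hs.2.2 (fun u h1 h2 k x hx hu => ?_) ?_
        · have hu' : u ∈ boxTimes M n t ∩ Set.Ioo s₀ t :=
            ⟨⟨h1.bot_lt, h2.le, k, x, hx, hu⟩, hs.2.1.trans h1, h2⟩
          exact absurd (hmax hu' h1.le) (not_le.2 h1)
        · refine ih _ ?_ s hs.2.1.le rfl
          rw [← hm]
          refine Set.ncard_lt_ncard ?_ hf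
          refine ⟨fun u hu => ⟨boxTimes_mono hs.2.2.le hu.1, hu.2.1, hu.2.2.trans hs.2.2⟩, fun h => ?_⟩
          exact (h hs).2.2.false
  intro t ht
  exact main _ t ht rfl

/-! ### Counting marks -/

/-- Number of points of `A` in `(0, t]`. -/
def cnt (A : Set ℝ≥0) (t : ℝ≥0) : ℕ := (A ∩ Set.Ioc 0 t).ncard

lemma cnt_zero (A : Set ℝ≥0) : cnt A 0 = 0 := by simp [cnt]

open Classical in
lemma cnt_eq_add {A : Set ℝ≥0} {s t : ℝ≥0} (hf : (A ∩ Set.Ioc 0 t).Finite) (hst : s < t)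
    (hq : ∀ u, s < u → u < t → u ∉ A) : cnt A t = cnt A s + if t ∈ A then 1 else 0 := by
  have hfs : (A ∩ Set.Ioc 0 s).Finite :=
    hf.subset fun u hu => ⟨hu.1, hu.2.1, hu.2.2.trans hst.le⟩
  have key : ∀ u, u ∈ A → u ≤ t → u ≤ s ∨ u = t := by
    intro u hu hut
    by_contra! h
    exact hq u h.1 (lt_of_le_of_ne hut h.2) hu
  unfold cnt
  split_ifs with ht
  · have : A ∩ Set.Ioc 0 t = insert t (A ∩ Set.Ioc 0 s) := by
      ext u
      simp only [Set.mem_inter_iff, Set.mem_Ioc, Set.mem_insert_iff]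
      constructor
      · rintro ⟨h1, h2, h3⟩
        rcases key u h1 h3 with h | h
        · exact Or.inr ⟨h1, h2, h⟩
        · exact Or.inl h
      · rintro (rfl | ⟨h1, h2, h3⟩)
        · exact ⟨ht, hst.bot_lt, le_rfl⟩
        · exact ⟨h1, h2, h3.trans hst.le⟩
    rw [this, Set.ncard_insert_of_notMem _ hfs]
    exact fun h => (h.2.2.trans_lt hst).false
  · rw [add_zero]
    congr 1
    ext u
    simp only [Set.mem_inter_iff, Set.mem_Ioc]
    constructor
    · rintro ⟨h1, h2, h3⟩
      rcases key u h1 h3 with h | rfl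
      · exact ⟨h1, h2, h⟩
      · exact absurd h1 ht
    · rintro ⟨h1, h2, h3⟩
      exact ⟨h1, h2, h3.trans hst.le⟩

/-- An environment of marks with finitely many marks on each edge in bounded time. -/
def LocallyFinite (M : Kind → ℤ → Set ℝ≥0) : Prop := ∀ k x t, (M k x ∩ Set.Ioc 0 t).Finite

lemma LocallyFinite.boxTimes_finite (hM : LocallyFinite M) (n : ℕ) (t : ℝ≥0) :
    (boxTimes M n t).Finite := by
  have : boxTimes M n t ⊆ ⋃ k : Kind, ⋃ x ∈ Set.Icc (-(n : ℤ)) n, M k x ∩ Set.Ioc 0 t := by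
    rintro u ⟨h1, h2, k, x, hx, hu⟩
    simp only [Set.mem_iUnion]
    exact ⟨k, x, abs_le.1 hx, hu, h1, h2⟩
  refine Set.Finite.subset ?_ this
  exact Set.finite_iUnion fun k => (Set.finite_Icc _ _).biUnion fun x _ => hM k x t

open Classical in
lemma LocallyFinite.cnt_eq (hM : LocallyFinite M) {s t : ℝ≥0} (hst : s < t) (hq : Quiet M n s t)
    (k : Kind) {x : ℤ} (hx : |x| ≤ (n : ℤ)) :
    cnt (M k x) t = cnt (M k x) s + if t ∈ M k x then 1 else 0 :=
  cnt_eq_add (hM k x t) hst fun u h1 h2 => hq u h1 h2 k x hx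

lemma LocallyFinite.cnt_mono (hM : LocallyFinite M) (k : Kind) (x : ℤ) : Monotone (cnt (M k x)) :=
  fun _ t hst => Set.ncard_le_ncard (fun _ hu => ⟨hu.1, hu.2.1, hu.2.2.trans hst⟩) (hM k x t)

lemma LocallyFinite.height_eq_step (hM : LocallyFinite M) {s t : ℝ≥0} (hst : s < t)
    (hq : Quiet M n s t) : boxHeight M n t = step M n t (boxHeight M n s) :=
  boxHeight_eq_step (hM.boxTimes_finite n t) hst hq

/-! ### Comparison with a finite system between infinitely high walls -/

lemma Kind.sum_eq {α : Type*} [AddCommMonoid α] (f : Kind → α) :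
    ∑ k, f k = f .leftR + (f .leftL + (f .rightR + (f .rightL + f .nuc))) := by
  change ∑ k ∈ ({.leftR, .leftL, .rightR, .rightL, .nuc} : Finset Kind), f k = _
  simp

/-- Exchange the roles of left and right particles. -/
def Kind.flip : Kind → Kind
  | .leftR => .leftL
  | .leftL => .leftR
  | .rightR => .rightL
  | .rightL => .rightR
  | .nuc => .nuc

/-- The marks that act on the profile `σ h`, in terms of those that act on `h`. -/
def sw (σ : ℤˣ) (k : Kind) : Kind := if σ = 1 then k else k.flip

lemma sw_involutive (σ : ℤˣ) : Function.Involutive (sw σ) := by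
  intro k
  unfold sw
  split_ifs
  · rfl
  · cases k <;> rfl

lemma rate_sw (σ : ℤˣ) (lam lam0 : ℝ≥0) (k : Kind) (x : ℤ) :
    rate lam lam0 (sw σ k) x = rate lam lam0 k x := by
  unfold sw
  split_ifs
  · rfl
  · cases k <;> rfl

open Classical in
/-- Effect of a mark in a system of `L` edges between two infinitely high walls, where
nucleations change the height by `σ`. -/
def wallEffect {L : ℕ} (σ : ℤˣ) (g : Fin L → ℤ) (i : Fin L) : Kind → ℤ
  | .leftR => if ∃ j : Fin L, (j : ℕ) = i + 1 ∧ g j < g i then -1 else 0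
  | .leftL => if ∀ j : Fin L, (j : ℕ) = i + 1 → g i < g j then 1 else 0
  | .rightR => if ∀ j : Fin L, (j : ℕ) + 1 = i → g i < g j then 1 else 0
  | .rightL => if ∃ j : Fin L, (j : ℕ) + 1 = i ∧ g j < g i then -1 else 0
  | .nuc => σ

lemma numLeft_pos {η : ℤ → ℤ} {x : ℤ} : 0 < numLeft η x ↔ η (x - 1) < η x := by simp [numLeft]

lemma numRight_pos {η : ℤ → ℤ} {x : ℤ} : 0 < numRight η x ↔ η x < η (x - 1) := by simp [numRight]

/-- Each kind of arrow either only raises or only lowers, and does so in the same direction for `σ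
η` and for `g`. A strict inequality at `i` therefore survives a jump of size one. If there is
equality at `i`, domination at the neighbour forces `σ η` down whenever `g` goes down, and `g` up
whenever `σ η` goes up. At the ends of the block the wall always allows raising and never lowering.
-/
lemma effect_le_wallEffect {L : ℕ} (σ : ℤˣ) (η : ℤ → ℤ) (g : Fin L → ℤ) (b : ℤ)
    (h : ∀ j : Fin L, σ * η (b + j) ≤ g j) (i : Fin L) (k : Kind) :
    σ * (η (b + i) + effect η (b + i) (sw σ k)) ≤ g i + wallEffect σ g i k := by
  have hi := h i
  have hnext : ∀ j : Fin L, (j : ℕ) = i + 1 → σ * η (b + i + 1) ≤ g j := by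
    intro j hj
    have := h j
    rw [hj] at this
    push_cast at this
    rwa [← add_assoc] at this
  have hprev : ∀ j : Fin L, (j : ℕ) + 1 = i → σ * η (b + i - 1) ≤ g j := by
    intro j hj
    have := h j
    have e : b + (i : ℤ) - 1 = b + (j : ℤ) := by rw [← hj]; push_cast; ring
    rwa [e]
  have e1 : b + (i : ℤ) + 1 - 1 = b + i := by ring
  rcases Int.units_eq_one_or σ with rfl | rfl
  · have hs : sw 1 k = k := by simp [sw]
    rw [hs]
    simp only [Units.val_one, one_mul] at *
    cases k <;> simp only [effect, wallEffect, Units.val_one]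
    · by_cases h2 : ∃ j : Fin L, (j : ℕ) = i + 1 ∧ g j < g i
      · rw [if_pos h2]
        obtain ⟨j, hj, hlt⟩ := h2
        have := hnext j hj
        split_ifs with h1 <;> rw [numRight_pos, e1] at h1 <;> omega
      · rw [if_neg h2]
        split_ifs <;> omega
    · by_cases h2 : ∀ j : Fin L, (j : ℕ) = i + 1 → g i < g j
      · rw [if_pos h2]
        split_ifs <;> omega
      · rw [if_neg h2]
        push Not at h2
        obtain ⟨j, hj, hlt⟩ := h2
        have := hnext j hj
        split_ifs with h1 <;> rw [numLeft_pos, e1] at h1 <;> omega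
    · by_cases h2 : ∀ j : Fin L, (j : ℕ) + 1 = i → g i < g j
      · rw [if_pos h2]
        split_ifs <;> omega
      · rw [if_neg h2]
        push Not at h2
        obtain ⟨j, hj, hlt⟩ := h2
        have := hprev j hj
        split_ifs with h1 <;> rw [numRight_pos] at h1 <;> omega
    · by_cases h2 : ∃ j : Fin L, (j : ℕ) + 1 = i ∧ g j < g i
      · rw [if_pos h2]
        obtain ⟨j, hj, hlt⟩ := h2
        have := hprev j hj
        split_ifs with h1 <;> rw [numLeft_pos] at h1 <;> omega
      · rw [if_neg h2]
        split_ifs <;> omega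
    · linarith
  · have hs : sw (-1) k = k.flip := by simp [sw]
    rw [hs]
    simp only [Units.val_neg, Units.val_one, neg_mul, one_mul] at *
    cases k <;> simp only [effect, wallEffect, Kind.flip, Units.val_one, Units.val_neg]
    · by_cases h2 : ∃ j : Fin L, (j : ℕ) = i + 1 ∧ g j < g i
      · rw [if_pos h2]
        obtain ⟨j, hj, hlt⟩ := h2
        have := hnext j hj
        split_ifs with h1 <;> rw [numLeft_pos, e1] at h1 <;> omega
      · rw [if_neg h2]
        split_ifs <;> omega
    · by_cases h2 : ∀ j : Fin L, (j : ℕ) = i + 1 → g i < g j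
      · rw [if_pos h2]
        split_ifs <;> omega
      · rw [if_neg h2]
        push Not at h2
        obtain ⟨j, hj, hlt⟩ := h2
        have := hnext j hj
        split_ifs with h1 <;> rw [numRight_pos, e1] at h1 <;> omega
    · by_cases h2 : ∀ j : Fin L, (j : ℕ) + 1 = i → g i < g j
      · rw [if_pos h2]
        split_ifs <;> omega
      · rw [if_neg h2]
        push Not at h2
        obtain ⟨j, hj, hlt⟩ := h2
        have := hprev j hj
        split_ifs with h1 <;> rw [numLeft_pos] at h1 <;> omega
    · by_cases h2 : ∃ j : Fin L, (j : ℕ) + 1 = i ∧ g j < g i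
      · rw [if_pos h2]
        obtain ⟨j, hj, hlt⟩ := h2
        have := hprev j hj
        split_ifs with h1 <;> rw [numRight_pos] at h1 <;> omega
      · rw [if_neg h2]
        split_ifs <;> omega
    · linarith

/-- Action of a single mark in the system between walls. -/
def fire {L : ℕ} (σ : ℤˣ) (g : Fin L → ℤ) (c : Kind × Fin L) : Fin L → ℤ :=
  Function.update g c.2 (g c.2 + wallEffect σ g c.2 c.1)

open Classical in
/-- One time step of the system between walls, given the numbers of marks: a single mark acts
as it should, several marks raise all heights by their number. -/
def wallStep {L : ℕ} (σ : ℤˣ) (g : Fin L → ℤ) (m : Kind × Fin L → ℕ) : Fin L → ℤ :=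
  if h : ∃ c, m = Pi.single c 1 then fire σ g h.choose else fun i => g i + ∑ c, (m c : ℤ)

lemma wallStep_single {L : ℕ} (σ : ℤˣ) (g : Fin L → ℤ) (c : Kind × Fin L) :
    wallStep σ g (Pi.single c 1) = fire σ g c := by
  have h : ∃ c', (Pi.single c 1 : Kind × Fin L → ℕ) = Pi.single c' 1 := ⟨c, rfl⟩
  have hc : h.choose = c := by
    by_contra hne
    have := congrFun h.choose_spec c
    rw [Pi.single_eq_same, Pi.single_eq_of_ne (Ne.symm hne)] at this
    exact one_ne_zero this
  unfold wallStep
  rw [dif_pos h, hc]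

lemma step_apply {t : ℝ≥0} {η : ℤ → ℤ} {x : ℤ} (hx : |x| ≤ (n : ℤ)) :
    step M n t η x = η x + ∑ k, open Classical in if t ∈ M k x then effect η x k else 0 := by
  classical
  unfold step
  congr 1
  exact Finset.sum_congr rfl fun k _ => if_congr (and_iff_right hx) rfl rfl

lemma effect_abs_le (η : ℤ → ℤ) (x : ℤ) (k : Kind) : |effect η x k| ≤ 1 := by
  cases k <;> simp only [effect] <;> (try split_ifs) <;> simp

lemma LocallyFinite.abs_sub_le (hM : LocallyFinite M) {s t : ℝ≥0} (hst : s ≤ t) {x : ℤ}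
    (hx : |x| ≤ (n : ℤ)) :
    |boxHeight M n t x - boxHeight M n s x| ≤ ∑ k, ((cnt (M k x) t : ℤ) - cnt (M k x) s) := by
  classical
  refine mark_induction (hM.boxTimes_finite n) (s₀ := s)
    (Q := fun t => |boxHeight M n t x - boxHeight M n s x| ≤
      ∑ k, ((cnt (M k x) t : ℤ) - cnt (M k x) s)) (by simp) ?_ t hst
  intro u v _ huv hq ih
  rw [hM.height_eq_step huv hq, step_apply hx]
  have e : ∑ k, ((cnt (M k x) v : ℤ) - cnt (M k x) s) =
      ∑ k, ((cnt (M k x) u : ℤ) - cnt (M k x) s) + ∑ k, if v ∈ M k x then 1 else 0 := by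
    rw [← Finset.sum_add_distrib]
    refine Finset.sum_congr rfl fun k _ => ?_
    rw [hM.cnt_eq huv hq k hx]
    push_cast
    ring
  rw [e]
  have h2 : |∑ k, if v ∈ M k x then effect (boxHeight M n u) x k else 0| ≤
      ∑ k, if v ∈ M k x then (1 : ℤ) else 0 := by
    refine (Finset.abs_sum_le_sum_abs _ _).trans (Finset.sum_le_sum fun k _ => ?_)
    split_ifs
    · exact effect_abs_le _ _ _
    · simp
  calc _ = |(boxHeight M n u x - boxHeight M n s x) +
        ∑ k, if v ∈ M k x then effect (boxHeight M n u) x k else 0| := by congr 1; ring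
    _ ≤ _ := (abs_add_le _ _).trans (add_le_add ih h2)

/-- The numbers of marks in `(s, t]` on the edges of a half-box, in the order used by the
system between walls. -/
def markCount {L : ℕ} (M : Kind → ℤ → Set ℝ≥0) (σ : ℤˣ) (b : ℤ) (s t : ℝ≥0) (c : Kind × Fin L) :
    ℕ :=
  cnt (M (sw σ c.1) (b + c.2)) t - cnt (M (sw σ c.1) (b + c.2)) s

/-- Marks of the box outside the block may act at any time in the interval. They are harmless, since
domination is required on the block only and the walls dominate whatever happens outside. -/
lemma boxHeight_le_of_single (hM : LocallyFinite M) {L : ℕ} (σ : ℤˣ) {b : ℤ}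
    (hb : ∀ j : Fin L, |b + j| ≤ (n : ℤ)) {g : Fin L → ℤ} {s t : ℝ≥0} (hst : s ≤ t)
    (hg : ∀ j : Fin L, σ * boxHeight M n s (b + j) ≤ g j) (c : Kind × Fin L)
    (hc : markCount M σ b s t = Pi.single c 1) (i : Fin L) :
    σ * boxHeight M n t (b + i) ≤ fire σ g c i := by
  classical
  have hconst : ∀ c' ≠ c, ∀ u, s ≤ u → u ≤ t →
      cnt (M (sw σ c'.1) (b + c'.2)) u = cnt (M (sw σ c'.1) (b + c'.2)) s := by
    intro c' hc' u hsu hut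
    have h1 := congrFun hc c'
    rw [Pi.single_eq_of_ne hc'] at h1
    have h2 := hM.cnt_mono (sw σ c'.1) (b + c'.2) hsu
    have h3 := hM.cnt_mono (sw σ c'.1) (b + c'.2) hut
    unfold markCount at h1
    omega
  have hcc : cnt (M (sw σ c.1) (b + c.2)) t = cnt (M (sw σ c.1) (b + c.2)) s + 1 := by
    have h1 := congrFun hc c
    rw [Pi.single_eq_same] at h1
    unfold markCount at h1
    omega
  -- The count of the distinguished mark tells whether it has already occurred: before it `g`
  -- dominates, after it the updated profile does.
  suffices H : ∀ u, s ≤ u → (u ≤ t →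
      ((cnt (M (sw σ c.1) (b + c.2)) u = cnt (M (sw σ c.1) (b + c.2)) s →
        ∀ j : Fin L, σ * boxHeight M n u (b + j) ≤ g j) ∧
      (cnt (M (sw σ c.1) (b + c.2)) u = cnt (M (sw σ c.1) (b + c.2)) s + 1 →
        ∀ j : Fin L, σ * boxHeight M n u (b + j) ≤ fire σ g c j))) from
    (H t hst le_rfl).2 hcc i
  refine mark_induction (hM.boxTimes_finite n) (s₀ := s) (fun _ => ⟨fun _ => hg, fun h => by omega⟩) ?_
  intro u v hsu huv hq ih hvt
  obtain ⟨ih1, ih2⟩ := ih (huv.le.trans hvt)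
  have hnot : ∀ c' ≠ c, v ∉ M (sw σ c'.1) (b + c'.2) := by
    intro c' hc' hv
    have h1 := hconst c' hc' u hsu (huv.le.trans hvt)
    have h2 := hconst c' hc' v (hsu.trans huv.le) hvt
    have h3 := hM.cnt_eq huv hq (sw σ c'.1) (hb c'.2)
    rw [if_pos hv] at h3
    omega
  have hmono := hM.cnt_mono (sw σ c.1) (b + c.2) hsu
  have hcv := hM.cnt_eq huv hq (sw σ c.1) (hb c.2)
  have hval : ∀ j : Fin L, boxHeight M n v (b + j) = boxHeight M n u (b + j) +
      if j = c.2 ∧ v ∈ M (sw σ c.1) (b + c.2) then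
        effect (boxHeight M n u) (b + j) (sw σ c.1) else 0 := by
    intro j
    rw [hM.height_eq_step huv hq, step_apply (hb j)]
    congr 1
    by_cases hj : j = c.2
    · rw [Finset.sum_eq_single (sw σ c.1)]
      · subst hj
        simp
      · intro k _ hk
        rw [if_neg]
        have h5 := hnot (sw σ k, j) (fun h => hk (by rw [← h]; exact (sw_involutive σ k).symm))
        simpa [sw_involutive σ k] using h5
      · simp
    · rw [if_neg (fun h => hj h.1)]
      refine Finset.sum_eq_zero fun k _ => ?_
      rw [if_neg]
      have h5 := hnot (sw σ k, j) (fun h => hj (by rw [← h]))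
      simpa [sw_involutive σ k] using h5
  by_cases hv : v ∈ M (sw σ c.1) (b + c.2)
  · rw [if_pos hv] at hcv
    refine ⟨fun h => by omega, fun h j => ?_⟩
    have hu := ih1 (by omega)
    rw [hval j]
    unfold fire
    by_cases hj : j = c.2
    · subst hj
      rw [if_pos ⟨rfl, hv⟩, Function.update_self]
      exact effect_le_wallEffect σ _ g b hu c.2 c.1
    · rw [if_neg (fun h => hj h.1), Function.update_of_ne hj, add_zero]
      exact hu j
  · rw [if_neg hv] at hcv
    have hval' : ∀ j : Fin L, boxHeight M n v (b + j) = boxHeight M n u (b + j) := by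
      intro j
      rw [hval j, if_neg (fun h => hv h.2), add_zero]
    refine ⟨fun h j => ?_, fun h j => ?_⟩
    · rw [hval' j]; exact ih1 (by omega) j
    · rw [hval' j]; exact ih2 (by omega) j

/-- Without exactly one mark the bound is crude: no height moves by more than the number of marks of
the block. It is exact when there are none, and two or more marks have probability of second order
in the length of the interval, so nothing is lost in the growth rate. -/
lemma boxHeight_le_wallStep (hM : LocallyFinite M) {L : ℕ} (σ : ℤˣ) {b : ℤ}
    (hb : ∀ j : Fin L, |b + j| ≤ (n : ℤ)) {g : Fin L → ℤ} {s t : ℝ≥0} (hst : s ≤ t)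
    (hg : ∀ j : Fin L, σ * boxHeight M n s (b + j) ≤ g j) (i : Fin L) :
    σ * boxHeight M n t (b + i) ≤ wallStep σ g (markCount M σ b s t) i := by
  by_cases h : ∃ c, markCount (L := L) M σ b s t = Pi.single c 1
  · obtain ⟨c, hc⟩ := h
    rw [hc, wallStep_single]
    exact boxHeight_le_of_single hM σ hb hst hg c hc i
  · unfold wallStep
    rw [dif_neg h]
    have h1 := hM.abs_sub_le (n := n) hst (hb i)
    have h2 : ∑ k, ((cnt (M k (b + i)) t : ℤ) - cnt (M k (b + i)) s) ≤
        ∑ c : Kind × Fin L, (markCount M σ b s t c : ℤ) := by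
      have e : ∀ c : Kind × Fin L, (markCount M σ b s t c : ℤ) =
          (cnt (M (sw σ c.1) (b + c.2)) t : ℤ) - cnt (M (sw σ c.1) (b + c.2)) s := fun c =>
        Nat.cast_sub (hM.cnt_mono _ _ hst)
      rw [Fintype.sum_prod_type]
      rw [← (sw_involutive σ).bijective.sum_comp]
      refine Finset.sum_le_sum fun k _ => ?_
      rw [← e (k, i)]
      exact Finset.single_le_sum (f := fun j => (markCount M σ b s t (k, j) : ℤ))
        (fun _ _ => Int.natCast_nonneg _) (Finset.mem_univ i)
    have h3 : (σ : ℤ) * (boxHeight M n t (b + i) - boxHeight M n s (b + i)) ≤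
        |boxHeight M n t (b + i) - boxHeight M n s (b + i)| := by
      rcases Int.units_eq_one_or σ with rfl | rfl
      · simpa using le_abs_self (boxHeight M n t (b + i) - boxHeight M n s (b + i))
      · simpa using (neg_le_abs (boxHeight M n t (b + i) - boxHeight M n s (b + i)))
    have := hg i
    linarith

/-- The system between walls driven by the numbers of marks in successive time intervals. -/
def walk {L : ℕ} (σ : ℤˣ) (D : ℕ → Kind × Fin L → ℕ) : ℕ → Fin L → ℤ
  | 0 => 0
  | k + 1 => wallStep σ (walk σ D k) (D k)

lemma boxHeight_le_walk (hM : LocallyFinite M) {L : ℕ} (σ : ℤˣ) {b : ℤ}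
    (hb : ∀ j : Fin L, |b + j| ≤ (n : ℤ)) (δ : ℝ≥0) (k : ℕ) (i : Fin L) :
    σ * boxHeight M n (k * δ) (b + i) ≤
      walk σ (fun k => markCount M σ b (k * δ) ((k + 1 : ℕ) * δ)) k i := by
  induction k generalizing i with
  | zero => simp [boxHeight_zero, walk]
  | succ k ih =>
    refine boxHeight_le_wallStep hM σ hb ?_ ih i
    gcongr
    simp

/-! ### The height at the defect -/

/-- The change of `σ h(e_0)` if it keeps exceeding both of its neighbours. -/
def peakCount (M : Kind → ℤ → Set ℝ≥0) (σ : ℤˣ) (t : ℝ≥0) : ℤ :=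
  σ * cnt (M .nuc 0) t - cnt (M (sw σ .leftR) 0) t - cnt (M (sw σ .rightL) 0) t

/-- The time `s` is essentially the last one at which `e_0` was not strictly above both neighbours.
From then on, every arrow that could raise `σ h(e_0)` is ineffective and every arrow that could
lower it is effective. -/
lemma boxHeight_zero_le (hM : LocallyFinite M) (σ : ℤˣ) (t : ℝ≥0) :
    ∃ s ≤ t, σ * boxHeight M n t 0 ≤
      max (σ * boxHeight M n s 1) (σ * boxHeight M n s (-1)) +
        (peakCount M σ t - peakCount M σ s) + 8 := by
  classical
  refine mark_induction (hM.boxTimes_finite n) (s₀ := 0)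
    (Q := fun t => ∃ s ≤ t, σ * boxHeight M n t 0 ≤
      max (σ * boxHeight M n s 1) (σ * boxHeight M n s (-1)) +
        (peakCount M σ t - peakCount M σ s) + 8) ⟨0, le_rfl, by simp [boxHeight_zero]⟩ ?_ t zero_le
  intro u v _ huv hq ⟨s, hsu, ih⟩
  have hn : |(0 : ℤ)| ≤ (n : ℤ) := by simp
  have hp : peakCount M σ v = peakCount M σ u + (σ * (if v ∈ M .nuc 0 then 1 else 0)
      - (if v ∈ M (sw σ .leftR) 0 then 1 else 0) - (if v ∈ M (sw σ .rightL) 0 then 1 else 0)) := by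
    unfold peakCount
    rw [hM.cnt_eq huv hq _ hn, hM.cnt_eq huv hq _ hn, hM.cnt_eq huv hq _ hn]
    push_cast
    ring
  have hh := congrFun (hM.height_eq_step huv hq) 0
  rw [step_apply hn, Kind.sum_eq] at hh
  set η := boxHeight M n u with hη
  by_cases hpk : max (σ * η 1) (σ * η (-1)) < σ * η 0
  · refine ⟨s, hsu.trans huv.le, ?_⟩
    suffices h : (σ : ℤ) * boxHeight M n v 0 ≤ σ * η 0 + (peakCount M σ v - peakCount M σ u) by
      linarith
    rw [hp, hh]
    obtain ⟨h1, h2⟩ := max_lt_iff.1 hpk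
    rcases Int.units_eq_one_or σ with rfl | rfl
    · simp only [Units.val_one, one_mul] at h1 h2
      have a1 : 0 < numRight η (0 + 1) := by simp [numRight, h1]
      have a2 : ¬ 0 < numLeft η (0 + 1) := by simp [numLeft, h1.le]
      have a3 : ¬ 0 < numRight η 0 := by simp [numRight, h2.le]
      have a4 : 0 < numLeft η 0 := by simp [numLeft, h2]
      simp only [effect, if_pos a1, if_neg a2, if_neg a3, if_pos a4, sw, if_true, Units.val_one]
      split_ifs <;> norm_num
    · simp only [Units.val_neg, Units.val_one, neg_mul, one_mul, neg_lt_neg_iff] at h1 h2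
      have a1 : ¬ 0 < numRight η (0 + 1) := by simp [numRight, h1.le]
      have a2 : 0 < numLeft η (0 + 1) := by simp [numLeft, h1]
      have a3 : 0 < numRight η 0 := by simp [numRight, h2]
      have a4 : ¬ 0 < numLeft η 0 := by simp [numLeft, h2.le]
      have e : ((-1 : ℤˣ) = 1) = False := by simp
      simp only [effect, if_neg a1, if_pos a2, if_pos a3, if_neg a4, sw, e, if_false, Kind.flip,
        Units.val_neg, Units.val_one]
      split_ifs <;> norm_num
  · refine ⟨u, huv.le, ?_⟩
    have h1 := not_lt.1 hpk
    -- The constant is `8 = 5 + 3`: five kinds of marks move the height by at most one each, and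
    -- three of them move `peakCount` by at most one each. Simultaneous marks need not be excluded.
    suffices h : (σ : ℤ) * boxHeight M n v 0 ≤ σ * η 0 + (peakCount M σ v - peakCount M σ u) + 8 by
      linarith
    rw [hp, hh]
    have b : ∀ k, |if v ∈ M k 0 then effect η 0 k else 0| ≤ 1 := by
      intro k
      split_ifs
      · exact effect_abs_le _ _ _
      · simp
    have b1 := abs_le.1 (b .leftR)
    have b2 := abs_le.1 (b .leftL)
    have b3 := abs_le.1 (b .rightR)
    have b4 := abs_le.1 (b .rightL)
    have b5 := abs_le.1 (b .nuc)
    have d : ∀ k, 0 ≤ (if v ∈ M k 0 then (1 : ℤ) else 0) ∧ (if v ∈ M k 0 then (1 : ℤ) else 0) ≤ 1 := by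
      intro k
      split_ifs <;> simp
    have d1 := d .nuc
    have d2 := d (sw σ .leftR)
    have d3 := d (sw σ .rightL)
    rcases Int.units_eq_one_or σ with rfl | rfl
    · simp only [Units.val_one, one_mul]
      linarith
    · simp only [Units.val_neg, Units.val_one, neg_mul, one_mul]
      linarith

/-- Nucleations always act, and only the two kinds of arrows counted negatively can lower `e_0`,
each by one. -/
lemma peakCount_le_boxHeight (hM : LocallyFinite M) (t : ℝ≥0) :
    peakCount M 1 t ≤ boxHeight M n t 0 := by
  classical
  refine mark_induction (hM.boxTimes_finite n) (s₀ := 0)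
    (Q := fun t => peakCount M 1 t ≤ boxHeight M n t 0)
    (by simp [boxHeight_zero, peakCount, cnt_zero]) ?_ t zero_le
  intro u v _ huv hq ih
  have hn : |(0 : ℤ)| ≤ (n : ℤ) := by simp
  rw [hM.height_eq_step huv hq, step_apply hn, Kind.sum_eq]
  unfold peakCount at ih ⊢
  rw [hM.cnt_eq huv hq _ hn, hM.cnt_eq huv hq _ hn, hM.cnt_eq huv hq _ hn]
  simp only [sw, if_true, Units.val_one, effect] at ih ⊢
  push_cast
  split_ifs <;> omega

/-! ### Infinite volume -/

/-- The edges `a` and `b` stay at height zero and effects see nearest neighbours only, so what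
happens outside `[a, b]` cannot enter. -/
lemma boxHeight_eq_of_clear (hM : LocallyFinite M) {a b : ℤ} {t : ℝ≥0}
    (ha : ∀ k, ∀ u, 0 < u → u ≤ t → u ∉ M k a) (hb : ∀ k, ∀ u, 0 < u → u ≤ t → u ∉ M k b)
    {n' : ℕ} (hnn : n ≤ n') (han : |a| ≤ (n : ℤ)) (hbn : |b| ≤ (n : ℤ)) {x : ℤ}
    (hax : a ≤ x) (hxb : x ≤ b) : boxHeight M n' t x = boxHeight M n t x := by
  classical
  have hnn' : (n : ℤ) ≤ n' := by exact_mod_cast hnn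
  suffices H : ∀ v, 0 ≤ v → (v ≤ t → boxHeight M n' v a = 0 ∧ boxHeight M n' v b = 0 ∧
      ∀ x, a ≤ x → x ≤ b → boxHeight M n' v x = boxHeight M n v x) from
    (H t zero_le le_rfl).2.2 x hax hxb
  refine mark_induction (hM.boxTimes_finite n') (fun _ => by simp [boxHeight_zero]) ?_
  intro u v _ huv hq ih hvt
  obtain ⟨ih1, ih2, ih3⟩ := ih (huv.le.trans hvt)
  have hq' : Quiet M n u v := fun w h1 h2 k y hy => hq w h1 h2 k y (hy.trans hnn')
  have hclear : ∀ y, (∀ k, v ∉ M k y) → |y| ≤ (n : ℤ) → ∀ m : ℕ, n ≤ m → Quiet M m u v →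
      boxHeight M m v y = boxHeight M m u y := by
    intro y hy hyn m hm hqm
    rw [hM.height_eq_step huv hqm, step_apply (hyn.trans (by exact_mod_cast hm))]
    simp [hy]
  have hva : ∀ k, v ∉ M k a := fun k => ha k v huv.bot_lt hvt
  have hvb : ∀ k, v ∉ M k b := fun k => hb k v huv.bot_lt hvt
  refine ⟨(hclear a hva han n' hnn hq).trans ih1, (hclear b hvb hbn n' hnn hq).trans ih2, ?_⟩
  intro x hax hxb
  rcases hax.eq_or_lt with rfl | hax'
  · rw [hclear a hva han n' hnn hq, hclear a hva han n le_rfl hq', ih3 a le_rfl hxb]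
  rcases hxb.eq_or_lt with rfl | hxb'
  · rw [hclear x hvb hbn n' hnn hq, hclear x hvb hbn n le_rfl hq', ih3 x hax le_rfl]
  have hxn : |x| ≤ (n : ℤ) := by
    rw [abs_le] at *
    constructor <;> omega
  rw [hM.height_eq_step huv hq, hM.height_eq_step huv hq', step_apply (hxn.trans hnn'),
    step_apply hxn, ih3 x hax hxb]
  congr 1
  refine Finset.sum_congr rfl fun k _ => ?_
  have e0 := ih3 x hax hxb
  have e1 := ih3 (x + 1) (by omega) (by omega)
  have e2 := ih3 (x - 1) (by omega) (by omega)
  have e3 : x + 1 - 1 = x := by ring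
  congr 1
  cases k <;> simp only [effect, numLeft_pos, numRight_pos, e3, e0, e1, e2]

/-- On both sides there are arbitrarily far edges without marks before time `t`. -/
def HasClearEdges (M : Kind → ℤ → Set ℝ≥0) (t : ℝ≥0) : Prop :=
  (∀ m : ℕ, ∃ a : ℕ, m ≤ a ∧ ∀ k, ∀ u, 0 < u → u ≤ t → u ∉ M k a) ∧
    ∀ m : ℕ, ∃ a : ℕ, m ≤ a ∧ ∀ k, ∀ u, 0 < u → u ≤ t → u ∉ M k (-(a : ℤ))

lemma eventually_markHeight_eq (hM : LocallyFinite M) {t : ℝ≥0} (hc : HasClearEdges M t) (x : ℤ) :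
    ∀ᶠ n : ℕ in atTop, markHeight M t x = boxHeight M n t x := by
  obtain ⟨b, hb, hbc⟩ := hc.1 x.natAbs
  obtain ⟨a, ha, hac⟩ := hc.2 x.natAbs
  have hconst : ∀ n ≥ max a b, boxHeight M n t x = boxHeight M (max a b) t x := by
    intro n hn
    exact boxHeight_eq_of_clear hM hac hbc hn (by simp) (by simp) (by omega) (by omega)
  have hlim : Tendsto (fun n : ℕ => boxHeight M n t x) atTop (𝓝 (boxHeight M (max a b) t x)) :=
    tendsto_const_nhds.congr' (by
      filter_upwards [eventually_ge_atTop (max a b)] with n hn using (hconst n hn).symm)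
  filter_upwards [eventually_ge_atTop (max a b)] with n hn
  rw [hconst n hn]
  exact hlim.limUnder_eq

end Deterministic

/-! ### Jumps of counting paths -/

section Path

variable {f : ℝ≥0 → ℕ}

lemma finite_jumpTimes (hf : Monotone f) (t : ℝ≥0) : (jumpTimes f ∩ Set.Ioc 0 t).Finite := by
  have hinj : Set.InjOn f (jumpTimes f ∩ Set.Ioc 0 t) := by
    intro u hu v hv huv
    rcases lt_trichotomy u v with h | h | h
    · exact absurd huv (hv.1.2 u h).ne
    · exact h
    · exact absurd huv (hu.1.2 v h).ne'
  refine Set.Finite.of_finite_image ((Set.finite_Iic (f t)).subset ?_) hinj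
  rintro _ ⟨u, hu, rfl⟩
  exact hf hu.2.2

lemma cnt_jumpTimes_le (hf : Monotone f) (t : ℝ≥0) : cnt (jumpTimes f) t ≤ f t := by
  have : cnt (jumpTimes f) t ≤ (Set.Ioc 0 (f t)).ncard := by
    refine Set.ncard_le_ncard_of_injOn f ?_ ?_ (Set.finite_Ioc _ _)
    · intro u hu
      exact ⟨(Nat.zero_le _).trans_lt (hu.1.2 0 hu.2.1), hf hu.2.2⟩
    · intro u hu v hv huv
      rcases lt_trichotomy u v with h | h | h
      · exact absurd huv (hv.1.2 u h).ne
      · exact h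
      · exact absurd huv (hu.1.2 v h).ne'
  simpa using this

/-- The jump is the first time the path exceeds `f s`. Right continuity with discrete values shows
that this infimum is attained. -/
lemma exists_jumpTime (hf : Monotone f) (hc : ∀ t, ContinuousWithinAt f (Set.Ici t) t)
    {s t : ℝ≥0} (hst : f s < f t) : ∃ u ∈ jumpTimes f, s < u ∧ u ≤ t := by
  set S : Set ℝ≥0 := {u | f s < f u} with hS
  have hne : S.Nonempty := ⟨t, hst⟩
  have hbdd : BddBelow S := OrderBot.bddBelow S
  have hmem : sInf S ∈ S := by
    have h1 : ∀ᶠ u in 𝓝[≥] (sInf S), f u = f (sInf S) := by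
      have := hc (sInf S)
      rw [ContinuousWithinAt, nhds_discrete, tendsto_pure] at this
      exact this
    obtain ⟨w, hw, hI⟩ := mem_nhdsGE_iff_exists_Ico_subset.1 h1
    obtain ⟨v, hv, hvw⟩ := exists_lt_of_csInf_lt hne hw
    have h2 : f v = f (sInf S) := hI ⟨csInf_le hbdd hv, hvw⟩
    change f s < f (sInf S)
    rw [← h2]
    exact hv
  have hlt : s < sInf S := by
    by_contra h
    exact absurd (hf (not_lt.1 h)) (not_le.2 hmem)
  refine ⟨sInf S, ⟨hlt.bot_lt, fun u hu => ?_⟩, hlt, csInf_le hbdd hst⟩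
  have : u ∉ S := fun h => absurd (csInf_le hbdd h) (not_le.2 hu)
  exact (not_lt.1 this).trans_lt hmem

lemma le_cnt_of_le_succ (hf : Monotone f) (hc : ∀ t, ContinuousWithinAt f (Set.Ici t) t)
    {s t : ℝ≥0} (hst : s ≤ t) (h1 : f t ≤ f s + 1) (h : f s ≤ cnt (jumpTimes f) s) :
    f t ≤ cnt (jumpTimes f) t := by
  have hsub : jumpTimes f ∩ Set.Ioc 0 s ⊆ jumpTimes f ∩ Set.Ioc 0 t :=
    fun u hu => ⟨hu.1, hu.2.1, hu.2.2.trans hst⟩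
  rcases (hf hst).eq_or_lt with he | hlt
  · rw [← he]
    exact h.trans (Set.ncard_le_ncard hsub (finite_jumpTimes hf t))
  · obtain ⟨u, hu, hsu, hut⟩ := exists_jumpTime hf hc hlt
    have : cnt (jumpTimes f) s < cnt (jumpTimes f) t := by
      refine Set.ncard_lt_ncard ⟨hsub, fun hh => ?_⟩ (finite_jumpTimes hf t)
      exact absurd (hh ⟨hu, hsu.bot_lt, hut⟩).2.2 (not_le.2 hsu)
    omega

/-- A jump of size two would be counted only once. A grid on which every increment is at most one
excludes this: each cell where `f` grows contributes a jump time of its own. -/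
lemma cnt_jumpTimes_eq (hf : Monotone f) (hc : ∀ t, ContinuousWithinAt f (Set.Ici t) t)
    (h0 : f 0 = 0) {T m : ℕ} (hm : 0 < m)
    (hgrid : ∀ k < T * m, f ((k + 1 : ℕ) / m) ≤ f (k / m) + 1) {t : ℝ≥0} (ht : t < T) :
    cnt (jumpTimes f) t = f t := by
  refine le_antisymm (cnt_jumpTimes_le hf t) ?_
  have hm' : (0 : ℝ≥0) < m := by exact_mod_cast hm
  have hind : ∀ k ≤ T * m, f (k / m) ≤ cnt (jumpTimes f) (k / m) := by
    intro k
    induction k with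
    | zero => intro _; simp [h0]
    | succ k ih =>
      intro hk
      refine le_cnt_of_le_succ hf hc ?_ (hgrid k (by omega)) (ih (by omega))
      gcongr
      simp
  set k := ⌊t * m⌋₊ with hk
  have h1 : (k : ℝ≥0) / m ≤ t := by
    rw [div_le_iff₀ hm']
    exact Nat.floor_le zero_le
  have h2 : t ≤ ((k + 1 : ℕ) : ℝ≥0) / m := by
    rw [le_div_iff₀ hm']
    push_cast
    exact (Nat.lt_floor_add_one (t * m)).le
  have h3 : k < T * m := by
    rw [hk, Nat.floor_lt zero_le]
    push_cast
    gcongr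
  exact le_cnt_of_le_succ hf hc h1 ((hf h2).trans (hgrid k h3)) (hind k h3.le)

end Path

/-! ### Poisson processes -/

lemma poissonMeasure_two_le (a : ℝ≥0) :
    poissonMeasure a {n | 2 ≤ n} ≤ ENNReal.ofReal ((a : ℝ) ^ 2) := by
  have hc : {n : ℕ | 2 ≤ n} = ({0, 1} : Set ℕ)ᶜ := by
    ext n
    simp only [Set.mem_ofPred_eq, Set.mem_compl_iff, Set.mem_insert_iff, Set.mem_singleton_iff]
    omega
  have h01 : (poissonMeasure a).real {0, 1} = Real.exp (-a) * (1 + a) := by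
    rw [show ({0, 1} : Set ℕ) = {0} ∪ {1} from rfl,
      measureReal_union (by simp) (measurableSet_singleton _), poissonMeasure_real_singleton,
      poissonMeasure_real_singleton]
    simp
    ring
  rw [hc, ← ofReal_measureReal, measureReal_compl (by measurability), h01]
  refine ENNReal.ofReal_le_ofReal ?_
  simp only [probReal_univ]
  -- By this bound, `1 - exp (-a) (1 + a) ≤ 1 - (1 - a) (1 + a) = a²`.
  have h1 := Real.add_one_le_exp (-(a : ℝ))
  have h2 : (0 : ℝ) ≤ a := a.2
  nlinarith

lemma hasSum_poisson_id (r : ℝ≥0) :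
    HasSum (fun n : ℕ => Real.exp (-r) * r ^ n / (n.factorial : ℝ) * (n : ℝ)) r := by
  rw [← hasSum_nat_add_iff' 1]
  have := (hasSum_one_poissonMeasure r).mul_left (r : ℝ)
  simp only [mul_one] at this
  convert! this using 1
  · funext n
    rw [Nat.factorial_succ]
    push_cast
    field_simp
    ring
  · simp

lemma integrable_poisson_id (r : ℝ≥0) : Integrable (fun n : ℕ => (n : ℝ)) (poissonMeasure r) := by
  rw [integrable_poissonMeasure_iff]
  simpa using (hasSum_poisson_id r).summable

lemma integral_poisson_id (r : ℝ≥0) : ∫ n : ℕ, (n : ℝ) ∂(poissonMeasure r) = r := by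
  rw [integral_poissonMeasure]
  simpa using (hasSum_poisson_id r).tsum_eq

section Poisson

variable {Ω : Type*} [MeasurableSpace Ω] {P : Measure Ω} {r : ℝ≥0} {N : ℝ≥0 → Ω → ℕ}

lemma IsPoissonProcess.measure_two_le (h : IsPoissonProcess P r N) {s t : ℝ≥0} (hst : s ≤ t) :
    P {ω | N s ω + 2 ≤ N t ω} ≤ ENNReal.ofReal ((r * (t - s) : ℝ≥0) ^ 2) := by
  refine le_trans ?_ (poissonMeasure_two_le (r * (t - s)))
  rw [← (h.law s t hst).map_eq, Measure.map_apply_of_aemeasurable (h.law s t hst).aemeasurable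
    (by measurability)]
  refine measure_mono fun ω hω => ?_
  simp only [Set.mem_ofPred_eq, Set.mem_preimage] at *
  omega

/-- Union bound: `T m` cells, each with at least two points with probability at most `(r / m)²`,
have total probability at most `T r² / m`, which vanishes as `m → ∞`. -/
lemma IsPoissonProcess.ae_grid (h : IsPoissonProcess P r N) (T : ℕ) :
    ∀ᵐ ω ∂P, ∃ m : ℕ, 0 < m ∧
      ∀ k < T * m, N ((k + 1 : ℕ) / m) ω ≤ N (k / m) ω + 1 := by
  have hbound : ∀ m : ℕ, 0 < m →
      P {ω | ¬ ∀ k < T * m, N ((k + 1 : ℕ) / m) ω ≤ N (k / m) ω + 1} ≤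
        ENNReal.ofReal (T * (r : ℝ) ^ 2 / m) := by
    intro m hm
    have hm' : (0 : ℝ) < m := by exact_mod_cast hm
    have hsub : {ω | ¬ ∀ k < T * m, N ((k + 1 : ℕ) / m) ω ≤ N (k / m) ω + 1} ⊆
        ⋃ k ∈ Finset.range (T * m), {ω | N (k / m) ω + 2 ≤ N ((k + 1 : ℕ) / m) ω} := by
      intro ω hω
      simp only [Set.mem_ofPred_eq, not_forall] at hω
      obtain ⟨k, hk, hlt⟩ := hω
      simp only [Set.mem_iUnion, Finset.mem_range]
      exact ⟨k, hk, by simp only [Set.mem_ofPred_eq]; omega⟩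
    refine (measure_mono hsub).trans ((measure_biUnion_finset_le _ _).trans ?_)
    have hk : ∀ k ∈ Finset.range (T * m), P {ω | N (k / m) ω + 2 ≤ N ((k + 1 : ℕ) / m) ω} ≤
        ENNReal.ofReal ((r / m : ℝ) ^ 2) := by
      intro k _
      have hle : (k : ℝ≥0) / m ≤ ((k + 1 : ℕ) : ℝ≥0) / m := by gcongr; simp
      refine (h.measure_two_le hle).trans (le_of_eq ?_)
      congr 2
      rw [NNReal.coe_mul, NNReal.coe_sub hle]
      push_cast
      field_simp
      ring
    refine (Finset.sum_le_sum hk).trans ?_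
    rw [Finset.sum_const, Finset.card_range, nsmul_eq_mul, ← ENNReal.ofReal_natCast,
      ← ENNReal.ofReal_mul (by positivity)]
    refine ENNReal.ofReal_le_ofReal (le_of_eq ?_)
    push_cast
    field_simp
  rw [ae_iff]
  refine le_antisymm ?_ zero_le
  have hlim : Tendsto (fun m : ℕ => ENNReal.ofReal (T * (r : ℝ) ^ 2 / m)) atTop (𝓝 0) := by
    rw [← ENNReal.ofReal_zero]
    exact ENNReal.tendsto_ofReal (tendsto_const_div_atTop_nhds_zero_nat _)
  refine ge_of_tendsto hlim ?_
  filter_upwards [eventually_gt_atTop 0] with m hm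
  refine (measure_mono fun ω hω => ?_).trans (hbound m hm)
  simp only [Set.mem_ofPred_eq, not_exists, not_and] at *
  exact hω m hm

lemma IsPoissonProcess.ae_cnt_eq (h : IsPoissonProcess P r N) :
    ∀ᵐ ω ∂P, ∀ t, cnt (jumpTimes fun s => N s ω) t = N t ω := by
  have hg : ∀ᵐ ω ∂P, ∀ T : ℕ, ∃ m : ℕ, 0 < m ∧
      ∀ k < T * m, N ((k + 1 : ℕ) / m) ω ≤ N (k / m) ω + 1 := ae_all_iff.2 h.ae_grid
  filter_upwards [h.zero, h.monotone, h.rightCts, hg] with ω h0 hmono hc hg t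
  obtain ⟨T, hT⟩ := exists_nat_gt t
  obtain ⟨m, hm, hgrid⟩ := hg T
  exact cnt_jumpTimes_eq (f := fun s => N s ω) hmono hc h0 hm hgrid hT

lemma IsPoissonProcess.ae_tendsto_nat (h : IsPoissonProcess P r N) :
    ∀ᵐ ω ∂P, Tendsto (fun n : ℕ => (N n ω : ℝ) / n) atTop (𝓝 r) := by
  set X : ℕ → Ω → ℝ := fun n ω => ((N (n + 1 : ℕ) ω - N (n : ℕ) ω : ℕ) : ℝ) with hX
  have hlaw : ∀ n : ℕ, HasLaw (fun ω => N (n + 1 : ℕ) ω - N (n : ℕ) ω) (poissonMeasure r) P := by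
    intro n
    have := h.law (n : ℕ) (n + 1 : ℕ) (by simp)
    have e : r * (((n + 1 : ℕ) : ℝ≥0) - (n : ℕ)) = r := by
      rw [Nat.cast_add, add_tsub_cancel_left]
      simp
    rwa [e] at this
  have hindep : iIndepFun X P := by
    have := h.indep.nat (t := fun n : ℕ => (n : ℝ≥0)) Nat.mono_cast
    exact this.comp (fun _ (m : ℕ) => (m : ℝ)) (fun _ => .of_discrete)
  have hident : ∀ n, IdentDistrib (X n) (X 0) P P := by
    intro n
    have : IdentDistrib (fun ω => N (n + 1 : ℕ) ω - N (n : ℕ) ω)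
        (fun ω => N (0 + 1 : ℕ) ω - N (0 : ℕ) ω) P P :=
      ⟨(hlaw n).aemeasurable, (hlaw 0).aemeasurable, by rw [(hlaw n).map_eq, (hlaw 0).map_eq]⟩
    exact this.comp (u := fun m : ℕ => (m : ℝ)) .of_discrete
  have hint : Integrable (X 0) P := by
    have := integrable_poisson_id r
    rw [← (hlaw 0).map_eq] at this
    exact this.comp_aemeasurable (hlaw 0).aemeasurable
  have hmean : P[X 0] = (r : ℝ) := by
    rw [← integral_poisson_id r, ← (hlaw 0).map_eq,
      integral_map (hlaw 0).aemeasurable (by exact AEStronglyMeasurable.of_discrete)]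
  have := strong_law_ae_real X hint (fun i j hij => hindep.indepFun hij) hident
  rw [hmean] at this
  filter_upwards [this, h.zero, h.monotone] with ω hlim h0 hmono
  convert hlim using 3 with n
  have : ∀ i : ℕ, X i ω = (N (i + 1 : ℕ) ω : ℝ) - N (i : ℕ) ω := by
    intro i
    simp only [hX]
    rw [Nat.cast_sub]
    exact hmono (by simp)
  simp_rw [this]
  rw [Finset.sum_range_sub (fun i : ℕ => (N i ω : ℝ))]
  simp [h0]

lemma tendsto_div_of_monotone {f : ℝ≥0 → ℕ} (hf : Monotone f) {r : ℝ}
    (h : Tendsto (fun n : ℕ => (f n : ℝ) / n) atTop (𝓝 r)) :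
    Tendsto (fun t : ℝ≥0 => (f t : ℝ) / t) atTop (𝓝 r) := by
  have hco : Tendsto (fun t : ℝ≥0 => (t : ℝ)) atTop atTop := NNReal.tendsto_coe_atTop.2 tendsto_id
  have hfl : Tendsto (fun t : ℝ≥0 => ⌊(t : ℝ)⌋₊) atTop atTop := tendsto_nat_floor_atTop.comp hco
  have hfl' : Tendsto (fun t : ℝ≥0 => ⌊(t : ℝ)⌋₊ + 1) atTop atTop :=
    (tendsto_add_atTop_nat 1).comp hfl
  have hq : Tendsto (fun t : ℝ≥0 => (⌊(t : ℝ)⌋₊ : ℝ) / t) atTop (𝓝 1) :=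
    (tendsto_nat_floor_div_atTop (R := ℝ)).comp hco
  have hq' : Tendsto (fun t : ℝ≥0 => ((⌊(t : ℝ)⌋₊ + 1 : ℕ) : ℝ) / t) atTop (𝓝 1) := by
    have := hq.add (tendsto_inv_atTop_zero.comp hco)
    rw [add_zero] at this
    refine this.congr fun t => ?_
    simp only [Function.comp]
    push_cast
    ring
  have l1 := (h.comp hfl).mul hq
  have l2 := (h.comp hfl').mul hq'
  rw [mul_one] at l1 l2
  refine tendsto_of_tendsto_of_tendsto_of_le_of_le' l1 l2 ?_ ?_
  · filter_upwards [eventually_ge_atTop 1] with t ht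
    have ht' : (0 : ℝ) < t := by exact_mod_cast lt_of_lt_of_le one_pos ht
    have hpos : (0 : ℝ) < ⌊(t : ℝ)⌋₊ := by
      exact_mod_cast Nat.floor_pos.2 (by exact_mod_cast ht)
    simp only [Function.comp]
    rw [div_mul_div_cancel₀ hpos.ne']
    have hle : ((⌊(t : ℝ)⌋₊ : ℕ) : ℝ≥0) ≤ t := by
      rw [← NNReal.coe_le_coe]
      exact_mod_cast Nat.floor_le t.2
    gcongr
    exact hf hle
  · filter_upwards [eventually_ge_atTop 1] with t ht
    have ht' : (0 : ℝ) < t := by exact_mod_cast lt_of_lt_of_le one_pos ht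
    simp only [Function.comp]
    rw [div_mul_div_cancel₀ (by positivity)]
    have hle : t ≤ ((⌊(t : ℝ)⌋₊ + 1 : ℕ) : ℝ≥0) := by
      rw [← NNReal.coe_le_coe]
      push_cast
      exact (Nat.lt_floor_add_one (t : ℝ)).le
    gcongr
    exact hf hle

lemma IsPoissonProcess.ae_tendsto (h : IsPoissonProcess P r N) :
    ∀ᵐ ω ∂P, Tendsto (fun t : ℝ≥0 => (N t ω : ℝ) / t) atTop (𝓝 r) := by
  filter_upwards [h.ae_tendsto_nat, h.monotone] with ω h1 h2
  exact tendsto_div_of_monotone h2 h1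

lemma IsPoissonProcess.measure_eq_zero (h : IsPoissonProcess P r N) (t : ℝ≥0) :
    P {ω | N t ω = 0} = ENNReal.ofReal (Real.exp (-(r * t))) := by
  have h1 := (h.law 0 t zero_le).measure_eq (p := fun n => n = 0) (by measurability)
  have h2 : {ω | N t ω = 0} =ᵐ[P] {ω | N t ω - N 0 ω = 0} := by
    filter_upwards [h.zero] with ω h0
    change (N t ω = 0) = (N t ω - N 0 ω = 0)
    rw [h0, Nat.sub_zero]
  rw [measure_congr h2, h1]
  have : {x : ℕ | x = 0} = {0} := by ext; simp
  rw [this, poissonMeasure_singleton]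
  simp

end Poisson

/-! ### Typical environments -/

/-- The environment of marks of a Harris system. -/
def marks {Ω : Type*} (N : Kind × ℤ → ℝ≥0 → Ω → ℕ) (ω : Ω) : Kind → ℤ → Set ℝ≥0 :=
  fun k y => jumpTimes fun s => N (k, y) s ω

lemma notMem_marks {Ω : Type*} {N : Kind × ℤ → ℝ≥0 → Ω → ℕ} {ω : Ω} {k : Kind}
    {y : ℤ} {t u : ℝ≥0} (hm : Monotone fun s => N (k, y) s ω)
    (h : N (k, y) t ω = 0) (hut : u ≤ t) : u ∉ marks N ω k y := by
  intro hu
  have h1 := hu.2 0 hu.1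
  have h2 : N (k, y) u ω ≤ N (k, y) t ω := hm hut
  simp only at h1
  omega

section Harris

variable {Ω : Type*} [MeasurableSpace Ω] {P : Measure Ω} {lam lam0 : ℝ≥0}
  {N : Kind × ℤ → ℝ≥0 → Ω → ℕ}

/-- Second Borel–Cantelli lemma: the edges are independent, and away from the defect each is empty
up to time `t` with the same positive probability. -/
lemma IsHarrisSystem.frequently_clear [IsProbabilityMeasure P]
    (h : IsHarrisSystem P lam lam0 N) {e : ℕ → ℤ} (he : Function.Injective e) (he0 : ∀ j, e j ≠ 0) (t : ℝ≥0) :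
    ∀ᵐ ω ∂P, ∃ᶠ j in atTop, ∀ k, N (k, e j) t ω = 0 := by
  have hind : iIndepFun (fun (p : Kind × ℕ) ω => N (p.1, e p.2) t ω) P := by
    have h1 := h.indep.comp (fun _ (f : ℝ≥0 → ℕ) => f t) (fun _ => measurable_pi_apply t)
    refine h1.precomp (g := fun p : Kind × ℕ => (p.1, e p.2)) ?_
    rintro ⟨k, i⟩ ⟨l, j⟩ hij
    simp only [Prod.mk.injEq] at hij
    rw [hij.1, he hij.2]
  set B : ℕ → Set Ω := fun j => {ω | ∀ k, N (k, e j) t ω = 0} with hB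
  have hsing : ∀ p : Kind × ℕ, MeasurableSet {ω | N (p.1, e p.2) t ω = 0} := fun p =>
    (h.poisson (p.1, e p.2)).measurable t (measurableSet_singleton 0)
  have hBm : ∀ j, MeasurableSet (B j) := by
    intro j
    have : B j = ⋂ k, {ω | N (k, e j) t ω = 0} := by ext; simp [hB]
    rw [this]
    exact MeasurableSet.iInter fun k => hsing (k, j)
  have hprod : ∀ S : Finset ℕ, P (⋂ j ∈ S, B j) =
      ∏ j ∈ S, ∏ k, P {ω | N (k, e j) t ω = 0} := by
    intro S
    have h1 := hind.measure_inter_preimage_eq_mul (Finset.univ ×ˢ S) (sets := fun _ => {0})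
      (fun _ _ => measurableSet_singleton 0)
    rw [Finset.prod_product_right] at h1
    rw [show (⋂ j ∈ S, B j) = ⋂ i ∈ (Finset.univ : Finset Kind) ×ˢ S,
      (fun ω => N (i.1, e i.2) t ω) ⁻¹' {0} by
        ext ω
        simp only [hB, Set.mem_iInter, Set.mem_ofPred_eq, Finset.mem_product, Finset.mem_univ,
          true_and, Set.mem_preimage, Set.mem_singleton_iff, Prod.forall]
        exact ⟨fun H k j hj => H j hj k, fun H j hj k => H k j hj⟩]
    exact h1
  have hone : ∀ j, P (B j) = ∏ k, P {ω | N (k, e j) t ω = 0} := by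
    intro j
    simpa using hprod {j}
  have hBind : iIndepSet B P := by
    rw [iIndepSet_iff_meas_biInter hBm]
    intro S
    rw [hprod S]
    exact Finset.prod_congr rfl fun j _ => (hone j).symm
  have hval : ∀ j, P (B j) = ∏ k, ENNReal.ofReal (Real.exp (-(rate lam lam0 k 1 * t))) := by
    intro j
    rw [hone j]
    refine Finset.prod_congr rfl fun k _ => ?_
    rw [(h.poisson (k, e j)).measure_eq_zero t]
    have : rate lam lam0 k (e j) = rate lam lam0 k 1 := by
      cases k <;> simp [rate, he0 j]
    simp only [this]
  have hsum : ∑' j, P (B j) = ⊤ := by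
    simp_rw [hval]
    refine ENNReal.tsum_const_eq_top_of_ne_zero ?_
    rw [Finset.prod_ne_zero_iff]
    intro k _
    simp [Real.exp_pos]
  have hone' := measure_limsup_eq_one hBm hBind hsum
  have hlm : MeasurableSet (limsup B atTop) := MeasurableSet.measurableSet_limsup hBm
  have := (prob_compl_eq_zero_iff hlm).2 hone'
  rw [← mem_ae_iff] at this
  filter_upwards [this] with ω hω
  exact mem_limsup_iff_frequently_mem.1 hω

lemma IsHarrisSystem.ae_hasClearEdges [IsProbabilityMeasure P] (h : IsHarrisSystem P lam lam0 N) :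
    ∀ᵐ ω ∂P, ∀ t, HasClearEdges (marks N ω) t := by
  have h1 : ∀ᵐ ω ∂P, ∀ T : ℕ, ∃ᶠ j in atTop, ∀ k, N (k, ((j + 1 : ℕ) : ℤ)) T ω = 0 :=
    ae_all_iff.2 fun T => h.frequently_clear (e := fun j : ℕ => ((j + 1 : ℕ) : ℤ))
      (fun i j hij => by simpa using hij) (fun j => by positivity) T
  have h2 : ∀ᵐ ω ∂P, ∀ T : ℕ, ∃ᶠ j in atTop, ∀ k, N (k, -((j + 1 : ℕ) : ℤ)) T ω = 0 :=
    ae_all_iff.2 fun T => h.frequently_clear (e := fun j : ℕ => -((j + 1 : ℕ) : ℤ))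
      (fun i j hij => by simpa using hij) (fun j => by omega) T
  have hm : ∀ᵐ ω ∂P, ∀ c, Monotone fun t => N c t ω := ae_all_iff.2 fun c => (h.poisson c).monotone
  filter_upwards [h1, h2, hm] with ω h1 h2 hm t
  obtain ⟨T, hT⟩ := exists_nat_ge t
  refine ⟨fun m => ?_, fun m => ?_⟩
  · obtain ⟨j, hj, hc⟩ := (frequently_atTop.1 (h1 T)) m
    exact ⟨j + 1, by omega, fun k u _ hu => notMem_marks (hm _) (hc k) (hu.trans hT)⟩
  · obtain ⟨j, hj, hc⟩ := (frequently_atTop.1 (h2 T)) m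
    exact ⟨j + 1, by omega, fun k u _ hu => notMem_marks (hm _) (hc k) (hu.trans hT)⟩

lemma IsHarrisSystem.ae_locallyFinite (h : IsHarrisSystem P lam lam0 N) :
    ∀ᵐ ω ∂P, LocallyFinite (marks N ω) := by
  have hm : ∀ᵐ ω ∂P, ∀ c, Monotone fun t => N c t ω := ae_all_iff.2 fun c => (h.poisson c).monotone
  filter_upwards [hm] with ω hm k x t
  exact finite_jumpTimes (hm (k, x)) t

lemma IsHarrisSystem.ae_cnt_eq (h : IsHarrisSystem P lam lam0 N) :
    ∀ᵐ ω ∂P, ∀ k x t, cnt (marks N ω k x) t = N (k, x) t ω := by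
  have hm : ∀ᵐ ω ∂P, ∀ c : Kind × ℤ, ∀ t, cnt (jumpTimes fun s => N c s ω) t = N c t ω :=
    ae_all_iff.2 fun c => (h.poisson c).ae_cnt_eq
  filter_upwards [hm] with ω hm k x t
  exact hm (k, x) t

lemma IsHarrisSystem.ae_cnt_tendsto (h : IsHarrisSystem P lam lam0 N) :
    ∀ᵐ ω ∂P, ∀ k x, Tendsto (fun t : ℝ≥0 => (cnt (marks N ω k x) t : ℝ) / t) atTop
      (𝓝 (rate lam lam0 k x)) := by
  have hm : ∀ᵐ ω ∂P, ∀ c : Kind × ℤ, Tendsto (fun t : ℝ≥0 => (N c t ω : ℝ) / t) atTop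
      (𝓝 (rate lam lam0 c.1 c.2)) :=
    ae_all_iff.2 fun c => (h.poisson c).ae_tendsto
  filter_upwards [hm, h.ae_cnt_eq] with ω hm hc k x
  simp_rw [hc]
  exact hm (k, x)

end Harris

/-! ### Exponential moments of the system between walls -/

lemma exists_pos_lt_of_hasDerivAt {G : ℝ → ℝ} {G' : ℝ} (h : HasDerivAt G G' 0) (h' : G' < 0) :
    ∃ x > 0, G x < G 0 := by
  have h1 : Tendsto (slope G 0) (𝓝[>] 0) (𝓝 G') :=
    (hasDerivAt_iff_tendsto_slope.1 h).mono_left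
      (nhdsWithin_mono _ fun x hx => (ne_of_gt hx : x ≠ 0))
  obtain ⟨x, hx, hpos⟩ := ((h1.eventually (gt_mem_nhds h')).and self_mem_nhdsWithin).exists
  refine ⟨x, hpos, ?_⟩
  have hpos' : 0 < x := hpos
  rw [slope_def_field, sub_zero, div_lt_iff₀ hpos'] at hx
  linarith

/-- Intensities of the marks away from the defect. -/
def bulkRate (lam : ℝ≥0) : Kind → ℝ≥0
  | .nuc => lam
  | _ => 1 / 2

lemma rate_eq_bulkRate (lam lam0 : ℝ≥0) (k : Kind) {x : ℤ} (hx : x ≠ 0) :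
    rate lam lam0 k x = bulkRate lam k := by
  cases k <;> simp [rate, bulkRate, hx]

/-- The exponential functional of a profile. -/
def expSum {L : ℕ} (θ : ℝ) (g : Fin L → ℤ) : ℝ := ∑ i, Real.exp (θ * g i)

lemma expSum_nonneg {L : ℕ} (θ : ℝ) (g : Fin L → ℤ) : 0 ≤ expSum θ g :=
  Finset.sum_nonneg fun _ _ => (Real.exp_pos _).le

lemma expSum_fire {L : ℕ} (σ : ℤˣ) (θ : ℝ) (g : Fin L → ℤ) (c : Kind × Fin L) :
    expSum θ (fire σ g c) - expSum θ g =
      Real.exp (θ * g c.2) * (Real.exp (θ * wallEffect σ g c.2 c.1) - 1) := by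
  unfold expSum
  rw [← Finset.sum_sub_distrib, Finset.sum_eq_single c.2]
  · unfold fire
    rw [Function.update_self]
    push_cast
    rw [mul_add, Real.exp_add]
    ring
  · intro j _ hj
    unfold fire
    rw [Function.update_of_ne hj, sub_self]
  · simp

/-- Walking from `i` to each end costs at most the variation on that side, and the two sides
together use every increment once. -/
lemma add_le_two_mul_add_sum_abs {l : ℕ} (w : Fin (l + 1) → ℝ) (i : Fin (l + 1)) :
    w 0 + w (Fin.last l) ≤ 2 * w i + ∑ j : Fin l, |w j.succ - w j.castSucc| := by
  set f : ℕ → ℝ := fun n => w ⟨min n l, by omega⟩ with hf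
  have e : ∑ j : Fin l, |w j.succ - w j.castSucc| = ∑ j ∈ Finset.range l, |f (j + 1) - f j| := by
    rw [← Fin.sum_univ_eq_sum_range (fun j => |f (j + 1) - f j|)]
    refine Finset.sum_congr rfl fun j _ => ?_
    have h1 : f (j + 1) = w j.succ := by
      simp only [hf]; congr 1; ext; simp
    have h2 : f j = w j.castSucc := by
      simp only [hf]; congr 1; ext; simp
    rw [h1, h2]
  have hi : (i : ℕ) ≤ l := by omega
  have h0 : f 0 = w 0 := by simp [hf]
  have hl : f l = w (Fin.last l) := by simp only [hf]; congr 1; ext; simp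
  have hii : f i = w i := by simp only [hf]; congr 1; ext; simp [hi]
  have d1 := dist_le_range_sum_dist f i
  have d2 := dist_le_Ico_sum_dist f hi
  rw [e, ← Finset.sum_range_add_sum_Ico _ hi, ← h0, ← hl, ← hii]
  simp only [Real.dist_eq] at d1 d2
  have a1 := le_abs_self (f 0 - f i)
  have a2 := neg_le_abs (f i - f l)
  simp_rw [abs_sub_comm (f (_ + 1))]
  linarith

open Classical in
/-- Sign of the interaction with the right neighbour, or with the wall. -/
def signRight {L : ℕ} (g : Fin L → ℤ) (i : Fin L) : ℝ :=
  (if ∀ j : Fin L, (j : ℕ) = i + 1 → g i < g j then 1 else 0) -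
    if ∃ j : Fin L, (j : ℕ) = i + 1 ∧ g j < g i then 1 else 0

open Classical in
/-- Sign of the interaction with the left neighbour, or with the wall. -/
def signLeft {L : ℕ} (g : Fin L → ℤ) (i : Fin L) : ℝ :=
  (if ∀ j : Fin L, (j : ℕ) + 1 = i → g i < g j then 1 else 0) -
    if ∃ j : Fin L, (j : ℕ) + 1 = i ∧ g j < g i then 1 else 0

/-- Summation by parts: a pair of neighbours contributes minus the absolute difference of its
weights, as the lower one is pushed up and the higher one down. Only the two walls contribute
positively. -/
lemma sum_sign_le {l : ℕ} (θ : ℝ) (hθ : 0 ≤ θ) (g : Fin (l + 1) → ℤ) :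
    ∑ i, Real.exp (θ * g i) * (signRight g i + signLeft g i) ≤ 2 / (l + 1) * expSum θ g := by
  classical
  set w : Fin (l + 1) → ℝ := fun i => Real.exp (θ * g i) with hw
  have hmono : ∀ i j, g i ≤ g j → w i ≤ w j := by
    intro i j hij
    refine Real.exp_le_exp.2 (mul_le_mul_of_nonneg_left ?_ hθ)
    exact_mod_cast hij
  set s : Fin l → ℝ := fun j => (if g j.castSucc < g j.succ then 1 else 0) -
    if g j.succ < g j.castSucc then 1 else 0 with hs
  have hR : ∀ j : Fin l, signRight g j.castSucc = s j := by
    intro j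
    have e : ∀ i : Fin (l + 1), (i : ℕ) = (j.castSucc : ℕ) + 1 ↔ i = j.succ := by
      intro i; rw [Fin.ext_iff]; simp
    simp only [signRight, e, hs, forall_eq, exists_eq_left]
  have hRl : signRight g (Fin.last l) = 1 := by
    have e : ∀ i : Fin (l + 1), ¬ (i : ℕ) = (Fin.last l : ℕ) + 1 := by
      intro i; simp; omega
    unfold signRight
    rw [if_pos fun j hj => absurd hj (e j), if_neg fun ⟨j, hj, _⟩ => e j hj, sub_zero]
  have hL : ∀ j : Fin l, signLeft g j.succ = - s j := by
    intro j
    have e : ∀ i : Fin (l + 1), (i : ℕ) + 1 = (j.succ : ℕ) ↔ i = j.castSucc := by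
      intro i; rw [Fin.ext_iff]; simp
    simp only [signLeft, e, hs, forall_eq, exists_eq_left]
    ring
  have hL0 : signLeft g 0 = 1 := by
    simp [signLeft]
  have habs : ∀ j : Fin l, (w j.succ - w j.castSucc) * s j = |w j.succ - w j.castSucc| := by
    intro j
    rcases lt_trichotomy (g j.castSucc) (g j.succ) with h | h | h
    · rw [abs_of_nonneg (sub_nonneg.2 (hmono _ _ h.le))]
      simp only [hs, if_pos h, if_neg h.not_gt]
      ring
    · have : w j.succ = w j.castSucc := by simp only [hw, h]
      simp [this]
    · rw [abs_of_nonpos (sub_nonpos.2 (hmono _ _ h.le))]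
      simp only [hs, if_pos h, if_neg h.not_gt]
      ring
  have hsum : ∑ i, w i * (signRight g i + signLeft g i) =
      w 0 + w (Fin.last l) - ∑ j : Fin l, |w j.succ - w j.castSucc| := by
    simp_rw [mul_add, Finset.sum_add_distrib]
    rw [Fin.sum_univ_castSucc (fun i => w i * signRight g i),
      Fin.sum_univ_succ (fun i => w i * signLeft g i), hRl, hL0]
    simp_rw [hR, hL, ← habs, sub_mul, Finset.sum_sub_distrib, mul_neg, Finset.sum_neg_distrib]
    ring
  -- The quantity is at most `2 * w i` for every `i`; averaging over `i` produces the factor `1 / (l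
  -- + 1)`.
  have hall : ∑ _i : Fin (l + 1), (w 0 + w (Fin.last l) - ∑ j : Fin l, |w j.succ - w j.castSucc|) ≤
      ∑ i, 2 * w i := Finset.sum_le_sum fun i _ => by
    have := add_le_two_mul_add_sum_abs w i
    linarith
  rw [Finset.sum_const, Finset.card_univ, Fintype.card_fin, nsmul_eq_mul, ← Finset.mul_sum] at hall
  push_cast at hall
  rw [hsum, div_mul_eq_mul_div, le_div_iff₀ (by positivity), mul_comm]
  exact hall

/-- Growth rate of the exponential functional. -/
def growth (lam : ℝ≥0) (σ : ℤˣ) (L : ℕ) (θ : ℝ) : ℝ :=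
  lam * (Real.exp (θ * (σ : ℤ)) - 1) + (1 - Real.exp (-θ)) / L +
    (Real.exp θ + Real.exp (-θ) - 2)

lemma sum_rate_expSum_fire_le {l : ℕ} (lam : ℝ≥0) (σ : ℤˣ) (θ : ℝ) (hθ : 0 ≤ θ)
    (g : Fin (l + 1) → ℤ) :
    ∑ c : Kind × Fin (l + 1), (bulkRate lam c.1 : ℝ) * (expSum θ (fire σ g c) - expSum θ g) ≤
      growth lam σ (l + 1) θ * expSum θ g := by
  classical
  have hB : 0 ≤ 1 - Real.exp (-θ) := by
    have : Real.exp (-θ) ≤ 1 := Real.exp_le_one_iff.2 (by linarith)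
    linarith
  have hAB : 0 ≤ Real.exp θ + Real.exp (-θ) - 2 := by
    have h1 := Real.add_one_le_exp θ
    have h2 := Real.add_one_le_exp (-θ)
    linarith
  simp_rw [expSum_fire]
  rw [Fintype.sum_prod_type_right]
  have hsite : ∀ i : Fin (l + 1),
      ∑ k, (bulkRate lam k : ℝ) * (Real.exp (θ * g i) * (Real.exp (θ * wallEffect σ g i k) - 1)) ≤
      (1 - Real.exp (-θ)) / 2 * (Real.exp (θ * g i) * (signRight g i + signLeft g i)) +
        (lam * (Real.exp (θ * (σ : ℤ)) - 1) + (Real.exp θ + Real.exp (-θ) - 2)) *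
          Real.exp (θ * g i) := by
    intro i
    -- An upward jump contributes `exp θ - 1 = (1 - exp (-θ)) + (exp θ + exp (-θ) - 2)` and a
    -- downward one `-(1 - exp (-θ))`. The antisymmetric part feeds the sign sum; the nonnegative
    -- remainder is of order `θ²`.
    have key : ∀ p q : Prop, ∀ [Decidable p] [Decidable q],
        (Real.exp (θ * ((if p then 1 else 0 : ℤ) : ℝ)) - 1) +
          (Real.exp (θ * ((if q then -1 else 0 : ℤ) : ℝ)) - 1) ≤
        (1 - Real.exp (-θ)) * ((if p then 1 else 0) - (if q then 1 else 0)) +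
          (Real.exp θ + Real.exp (-θ) - 2) := by
      intro p q _ _
      split_ifs <;> simp <;> linarith
    have k1 := key (∀ j : Fin (l + 1), (j : ℕ) = i + 1 → g i < g j)
      (∃ j : Fin (l + 1), (j : ℕ) = i + 1 ∧ g j < g i)
    have k2 := key (∀ j : Fin (l + 1), (j : ℕ) + 1 = i → g i < g j)
      (∃ j : Fin (l + 1), (j : ℕ) + 1 = i ∧ g j < g i)
    rw [Kind.sum_eq]
    simp only [bulkRate, wallEffect]
    have hw := Real.exp_pos (θ * g i)
    have k3 := mul_le_mul_of_nonneg_left (add_le_add k1 k2) hw.le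
    push_cast at k3 ⊢
    unfold signRight signLeft
    linarith
  refine (Finset.sum_le_sum fun i _ => hsite i).trans ?_
  rw [Finset.sum_add_distrib, ← Finset.mul_sum, ← Finset.mul_sum]
  have h1 := mul_le_mul_of_nonneg_left (sum_sign_le θ hθ g) (by positivity : 0 ≤ (1 - Real.exp (-θ)) / 2)
  refine (add_le_add_left h1 _).trans (le_of_eq ?_)
  unfold growth
  change _ + _ * expSum θ g = _
  push_cast
  ring

/-- Exponential growth rates above `σ λ + 1 / L` are attained by small exponents. -/
lemma exists_growth_lt (lam : ℝ≥0) (σ : ℤˣ) (L : ℕ) {v : ℝ} (hv : (lam : ℝ) * (σ : ℤ) + 1 / L < v) :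
    ∃ θ > 0, growth lam σ L θ < θ * v := by
  -- The symmetric remainder has derivative zero at `θ = 0`, so only the nucleations and the wall
  -- term count.
  have h1 : HasDerivAt (fun θ : ℝ => growth lam σ L θ - θ * v)
      (lam * (σ : ℤ) + 1 / L - v) 0 := by
    unfold growth
    have e1 : HasDerivAt (fun θ : ℝ => Real.exp (θ * (σ : ℤ))) ((σ : ℤ) : ℝ) 0 := by
      have := ((hasDerivAt_id (0 : ℝ)).mul_const ((σ : ℤ) : ℝ)).exp
      simpa using this
    have e2 : HasDerivAt (fun θ : ℝ => Real.exp (-θ)) (-1) 0 := by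
      have := (hasDerivAt_id (0 : ℝ)).neg.exp
      simpa using this
    have e3 : HasDerivAt (fun θ : ℝ => Real.exp θ) 1 0 := by
      simpa using Real.hasDerivAt_exp 0
    have := (((((e1.sub_const 1).const_mul (lam : ℝ)).add ((e2.const_sub 1).div_const (L : ℝ))).add
      ((e3.add e2).sub_const 2)).sub ((hasDerivAt_id (0 : ℝ)).mul_const v))
    refine this.congr_deriv ?_
    ring
  obtain ⟨θ, hθ, hlt⟩ := exists_pos_lt_of_hasDerivAt h1 (by linarith)
  refine ⟨θ, hθ, ?_⟩
  have h0 : growth lam σ L 0 - 0 * v = 0 := by simp [growth]; norm_num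
  rw [h0] at hlt
  linarith

/-- Bound for the growth of the exponential functional in one time step of length `δ`, when the
total intensity of the marks is `R` and the growth rate is `K`. -/
def stepFactor (R θ K δ : ℝ) : ℝ :=
  Real.exp (R * δ * (Real.exp θ - 1)) - δ * Real.exp (-(R * δ)) * (R * (Real.exp θ - 1) - K)

/-- At `δ = 0` the product equals `1` and has derivative `K - θ * v < 0`: discretising time does not
change the growth rate to first order. -/
lemma exists_stepFactor_lt (R θ K : ℝ) {v : ℝ} (h : K < θ * v) :
    ∃ δ > 0, Real.exp (-(θ * v * δ)) * stepFactor R θ K δ < 1 := by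
  have h1 : HasDerivAt (fun δ : ℝ => Real.exp (-(θ * v * δ)) * stepFactor R θ K δ)
      (K - θ * v) 0 := by
    unfold stepFactor
    have e1 : HasDerivAt (fun δ : ℝ => Real.exp (-(θ * v * δ))) (-(θ * v)) 0 := by
      have := ((hasDerivAt_id (0 : ℝ)).const_mul (θ * v)).neg.exp
      simpa using this
    have e2 : HasDerivAt (fun δ : ℝ => Real.exp (-(R * δ))) (-R) 0 := by
      have := ((hasDerivAt_id (0 : ℝ)).const_mul R).neg.exp
      simpa using this
    have e3 : HasDerivAt (fun δ : ℝ => Real.exp (R * δ * (Real.exp θ - 1)))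
        (R * (Real.exp θ - 1)) 0 := by
      have := (((hasDerivAt_id (0 : ℝ)).const_mul R).mul_const (Real.exp θ - 1)).exp
      simpa using this
    have := e1.mul (e3.sub (((hasDerivAt_id (0 : ℝ)).mul e2).mul_const
      (R * (Real.exp θ - 1) - K)))
    refine this.congr_deriv ?_
    simp
    ring
  obtain ⟨δ, hδ, hlt⟩ := exists_pos_lt_of_hasDerivAt h1 (by linarith)
  refine ⟨δ, hδ, hlt.trans_eq ?_⟩
  simp [stepFactor]

/-! ### One time step -/

lemma hasSum_poisson_exp (a : ℝ≥0) (θ : ℝ) :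
    HasSum (fun n : ℕ => Real.exp (-a) * a ^ n / (n.factorial : ℝ) * Real.exp (θ * n))
      (Real.exp (a * (Real.exp θ - 1))) := by
  have h := (NormedSpace.expSeries_div_hasSum_exp (a * Real.exp θ : ℝ)).mul_left (Real.exp (-a))
  rw [← Real.exp_eq_exp_ℝ, ← Real.exp_add] at h
  convert! h using 1
  · funext n
    rw [mul_pow, ← Real.exp_nat_mul]
    ring_nf
  · ring_nf

lemma integrable_poisson_exp (a : ℝ≥0) (θ : ℝ) :
    Integrable (fun n : ℕ => Real.exp (θ * n)) (poissonMeasure a) := by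
  rw [integrable_poissonMeasure_iff]
  simpa using (hasSum_poisson_exp a θ).summable

lemma integral_poisson_exp (a : ℝ≥0) (θ : ℝ) :
    ∫ n : ℕ, Real.exp (θ * n) ∂(poissonMeasure a) = Real.exp (a * (Real.exp θ - 1)) := by
  rw [integral_poissonMeasure]
  simpa using (hasSum_poisson_exp a θ).tsum_eq

section OneStep

variable {C : Type*} [Fintype C] (a : C → ℝ≥0)

lemma integrable_exp_sum (θ : ℝ) :
    Integrable (fun m : C → ℕ => Real.exp (θ * ∑ c, (m c : ℝ)))
      (Measure.pi fun c => poissonMeasure (a c)) := by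
  simp_rw [Finset.mul_sum, Real.exp_sum]
  exact Integrable.fintype_prod fun c => integrable_poisson_exp (a c) θ

lemma integral_exp_sum (θ : ℝ) :
    ∫ m : C → ℕ, Real.exp (θ * ∑ c, (m c : ℝ)) ∂(Measure.pi fun c => poissonMeasure (a c)) =
      Real.exp ((∑ c, (a c : ℝ)) * (Real.exp θ - 1)) := by
  simp_rw [Finset.mul_sum, Real.exp_sum]
  rw [integral_fintype_prod_eq_prod (fun (_ : C) (n : ℕ) => Real.exp (θ * n))]
  simp_rw [integral_poisson_exp]
  rw [← Real.exp_sum, Finset.sum_mul]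

lemma pi_poisson_single [DecidableEq C] (c : C) :
    (Measure.pi fun c => poissonMeasure (a c)).real {Pi.single c 1} =
      Real.exp (-∑ c, (a c : ℝ)) * a c := by
  rw [measureReal_def, Measure.pi_singleton, ENNReal.toReal_prod]
  have : ∀ c', (poissonMeasure (a c') {(Pi.single c 1 : C → ℕ) c'}).toReal =
      Real.exp (-(a c')) * if c' = c then (a c : ℝ) else 1 := by
    intro c'
    rw [← measureReal_def, poissonMeasure_real_singleton]
    by_cases h : c' = c
    · subst h; simp
    · simp [h]
  simp_rw [this]
  rw [Finset.prod_mul_distrib, ← Real.exp_sum, Finset.sum_neg_distrib]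
  simp

end OneStep

/-- The first term treats every mark as raising all heights, which makes its mean explicit; the
indicators correct it on the events with a single mark. -/
lemma expSum_wallStep {L : ℕ} (σ : ℤˣ) (θ : ℝ) (g : Fin L → ℤ) (m : Kind × Fin L → ℕ) :
    expSum θ (wallStep σ g m) = expSum θ g * Real.exp (θ * ∑ c, (m c : ℝ)) -
      ∑ c, Set.indicator {Pi.single c 1}
        (fun _ => expSum θ g * Real.exp θ - expSum θ (fire σ g c)) m := by
  by_cases h : ∃ c, m = Pi.single c 1
  · obtain ⟨c, rfl⟩ := h
    rw [wallStep_single, Finset.sum_eq_single (f := fun c' => Set.indicator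
        {(Pi.single c' 1 : Kind × Fin L → ℕ)}
        (fun _ => expSum θ g * Real.exp θ - expSum θ (fire σ g c'))
        (Pi.single c 1 : Kind × Fin L → ℕ)) c]
    · have : ∑ c', ((Pi.single c 1 : Kind × Fin L → ℕ) c' : ℝ) = 1 := by
        rw [← Nat.cast_sum, Finset.sum_pi_single']
        simp
      rw [this]
      simp
    · intro c' _ hc'
      rw [Set.indicator_of_notMem]
      intro h
      have := congrFun (Set.mem_singleton_iff.1 h) c
      rw [Pi.single_eq_same, Pi.single_eq_of_ne (Ne.symm hc')] at this
      exact one_ne_zero this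
    · simp
  · rw [Finset.sum_eq_zero (f := fun c => Set.indicator {Pi.single c 1}
        (fun _ => expSum θ g * Real.exp θ - expSum θ (fire σ g c)) m), sub_zero]
    · unfold wallStep expSum
      rw [dif_neg h, Finset.sum_mul]
      refine Finset.sum_congr rfl fun i _ => ?_
      rw [← Real.exp_add]
      push_cast
      ring_nf
    · intro c _
      rw [Set.indicator_of_notMem]
      intro hm
      exact h ⟨c, hm⟩

/-- The mark `c` occurs alone with probability `exp (-R δ) * r_c * δ`, where `r_c` is its rate.
Summing the corrections over `c` brings in the generator, bounded by `sum_rate_expSum_fire_le`. -/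
lemma lintegral_expSum_wallStep_le {l : ℕ} (lam : ℝ≥0) (σ : ℤˣ) {θ : ℝ} (hθ : 0 ≤ θ) (δ : ℝ≥0)
    (g : Fin (l + 1) → ℤ) :
    ∫⁻ m, ENNReal.ofReal (expSum θ (wallStep σ g m)) ∂(Measure.pi fun c : Kind × Fin (l + 1) =>
        poissonMeasure (bulkRate lam c.1 * δ)) ≤
      ENNReal.ofReal (stepFactor (∑ c : Kind × Fin (l + 1), (bulkRate lam c.1 : ℝ)) θ
        (growth lam σ (l + 1) θ) δ) * ENNReal.ofReal (expSum θ g) := by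
  classical
  set ν := Measure.pi fun c : Kind × Fin (l + 1) => poissonMeasure (bulkRate lam c.1 * δ) with hν
  set R := ∑ c : Kind × Fin (l + 1), (bulkRate lam c.1 : ℝ) with hR
  have hRδ : ∑ c : Kind × Fin (l + 1), ((bulkRate lam c.1 * δ : ℝ≥0) : ℝ) = R * δ := by
    rw [hR, Finset.sum_mul]
    exact Finset.sum_congr rfl fun c _ => NNReal.coe_mul _ _
  have i1 : Integrable (fun m : Kind × Fin (l + 1) → ℕ =>
      expSum θ g * Real.exp (θ * ∑ c, (m c : ℝ))) ν := (integrable_exp_sum _ θ).const_mul _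
  have i2 : ∀ c ∈ (Finset.univ : Finset (Kind × Fin (l + 1))),
      Integrable (Set.indicator {(Pi.single c 1 : Kind × Fin (l + 1) → ℕ)}
        (fun _ => expSum θ g * Real.exp θ - expSum θ (fire σ g c))) ν := fun c _ =>
    (integrable_const _).indicator (measurableSet_singleton _)
  have hint : Integrable (fun m => expSum θ (wallStep σ g m)) ν := by
    simp_rw [expSum_wallStep]
    exact i1.sub (integrable_finsetSum _ i2)
  have hval : ∫ m, expSum θ (wallStep σ g m) ∂ν =
      expSum θ g * Real.exp (R * δ * (Real.exp θ - 1)) -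
        ∑ c : Kind × Fin (l + 1), Real.exp (-(R * δ)) * (bulkRate lam c.1 * δ) *
          (expSum θ g * Real.exp θ - expSum θ (fire σ g c)) := by
    simp_rw [expSum_wallStep]
    rw [integral_sub i1 (integrable_finsetSum _ i2), integral_finsetSum _ i2, integral_const_mul,
      integral_exp_sum, hRδ]
    congr 1
    refine Finset.sum_congr rfl fun c _ => ?_
    rw [integral_indicator_const _ (measurableSet_singleton _), pi_poisson_single, hRδ]
    simp
  have hW := expSum_nonneg θ g
  have hle : ∫ m, expSum θ (wallStep σ g m) ∂ν ≤ stepFactor R θ (growth lam σ (l + 1) θ) δ *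
      expSum θ g := by
    rw [hval]
    have e : ∑ c : Kind × Fin (l + 1), Real.exp (-(R * δ)) * (bulkRate lam c.1 * δ) *
        (expSum θ g * Real.exp θ - expSum θ (fire σ g c)) =
        Real.exp (-(R * δ)) * δ * (R * (Real.exp θ - 1) * expSum θ g -
          ∑ c : Kind × Fin (l + 1), (bulkRate lam c.1 : ℝ) *
            (expSum θ (fire σ g c) - expSum θ g)) := by
      have hR' : R * (Real.exp θ - 1) * expSum θ g = ∑ c : Kind × Fin (l + 1),
          (bulkRate lam c.1 : ℝ) * (Real.exp θ - 1) * expSum θ g := by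
        rw [hR, Finset.sum_mul, Finset.sum_mul]
      rw [hR', ← Finset.sum_sub_distrib, Finset.mul_sum]
      refine Finset.sum_congr rfl fun c _ => ?_
      ring
    rw [e]
    have h1 := sum_rate_expSum_fire_le lam σ θ hθ g
    have h2 : 0 ≤ Real.exp (-(R * δ)) * δ := by positivity
    have h3 := mul_le_mul_of_nonneg_left h1 h2
    unfold stepFactor
    linarith
  rw [← ofReal_integral_eq_lintegral_ofReal hint (ae_of_all _ fun m => expSum_nonneg θ _),
    ← ENNReal.ofReal_mul' hW]
  exact ENNReal.ofReal_le_ofReal hle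

/-! ### Almost sure bounds for the system between walls -/

lemma walk_congr {L : ℕ} (σ : ℤˣ) {D D' : ℕ → Kind × Fin L → ℕ} {k : ℕ}
    (h : ∀ j < k, D j = D' j) : walk σ D k = walk σ D' k := by
  induction k with
  | zero => rfl
  | succ k ih =>
    change wallStep σ (walk σ D k) (D k) = wallStep σ (walk σ D' k) (D' k)
    rw [ih fun j hj => h j (by omega), h k (by omega)]

/-- Numbers of marks on the edges of a half-box in the `k`-th time interval of length `δ`. -/
def increments {Ω : Type*} {L : ℕ} (N : Kind × ℤ → ℝ≥0 → Ω → ℕ) (σ : ℤˣ) (b : ℤ) (δ : ℝ≥0)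
    (k : ℕ) (ω : Ω) (c : Kind × Fin L) : ℕ :=
  N (sw σ c.1, b + c.2) ((k + 1 : ℕ) * δ) ω - N (sw σ c.1, b + c.2) (k * δ) ω

section Chain

variable {Ω : Type*} [MeasurableSpace Ω] {P : Measure Ω} {lam lam0 : ℝ≥0}
  {N : Kind × ℤ → ℝ≥0 → Ω → ℕ}

lemma IsHarrisSystem.measurable_increments {L : ℕ} (h : IsHarrisSystem P lam lam0 N) (σ : ℤˣ)
    (b : ℤ) (δ : ℝ≥0) (k : ℕ) (c : Kind × Fin L) :
    Measurable fun ω => increments N σ b δ k ω c :=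
  ((h.poisson _).measurable _).sub ((h.poisson _).measurable _)

lemma IsHarrisSystem.iIndepFun_increments {L : ℕ} (h : IsHarrisSystem P lam lam0 N) (σ : ℤˣ)
    (b : ℤ) (δ : ℝ≥0) :
    iIndepFun (fun (p : (Kind × Fin L) × ℕ) ω => increments N σ b δ p.2 ω p.1) P := by
  have : IsProbabilityMeasure P := h.indep.isProbabilityMeasure
  refine iIndepFun_uncurry' (X := fun (c : Kind × Fin L) k ω => increments N σ b δ k ω c)
    (fun c k => h.measurable_increments σ b δ k c) ?_ ?_
  · have h1 := h.indep.precomp (g := fun c : Kind × Fin L => (sw σ c.1, b + (c.2 : ℤ))) (by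
      rintro ⟨k, i⟩ ⟨k', i'⟩ hij
      simp only [Prod.mk.injEq, add_right_inj, Nat.cast_inj] at hij
      rw [(sw_involutive σ).injective hij.1, Fin.ext hij.2])
    exact h1.comp (fun _ (f : ℝ≥0 → ℕ) (k : ℕ) => f ((k + 1 : ℕ) * δ) - f (k * δ)) (fun _ =>
      measurable_pi_lambda _ fun k => (measurable_pi_apply _).sub (measurable_pi_apply _))
  · intro c
    exact (h.poisson (sw σ c.1, b + c.2)).indep.nat (t := fun k : ℕ => k * δ) fun i j hij => by
      dsimp only
      gcongr

lemma IsHarrisSystem.map_increments {L : ℕ} (h : IsHarrisSystem P lam lam0 N) (σ : ℤˣ)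
    {b : ℤ} (hb : ∀ i : Fin L, b + i ≠ 0) (δ : ℝ≥0) (k : ℕ) :
    P.map (increments (L := L) N σ b δ k) =
      Measure.pi fun c : Kind × Fin L => poissonMeasure (bulkRate lam c.1 * δ) := by
  have : IsProbabilityMeasure P := h.indep.isProbabilityMeasure
  have h1 := (h.iIndepFun_increments (L := L) σ b δ).precomp
    (g := fun c : Kind × Fin L => (c, k)) (fun c c' hc => (Prod.mk.inj hc).1)
  have h2 := (iIndepFun_iff_map_fun_eq_pi_map
    (fun c => (h.measurable_increments σ b δ k c).aemeasurable)).1 h1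
  refine h2.trans ?_
  congr 1
  funext c
  have hle : (k : ℝ≥0) * δ ≤ ((k + 1 : ℕ) : ℝ≥0) * δ := by gcongr; simp
  refine ((h.poisson (sw σ c.1, b + c.2)).law _ _ hle).map_eq.trans ?_
  dsimp only
  rw [rate_sw, rate_eq_bulkRate lam lam0 c.1 (hb c.2)]
  congr 2
  rw [Nat.cast_add, Nat.cast_one, add_mul, one_mul, add_tsub_cancel_left]

lemma IsHarrisSystem.measurable_walk {L : ℕ} (h : IsHarrisSystem P lam lam0 N) (σ : ℤˣ)
    (b : ℤ) (δ : ℝ≥0) (k : ℕ) :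
    Measurable fun ω => walk σ (fun k => increments (L := L) N σ b δ k ω) k := by
  induction k with
  | zero => exact measurable_const
  | succ k ih =>
    exact (Measurable.of_discrete (f := fun p : (Fin L → ℤ) × (Kind × Fin L → ℕ) =>
      wallStep σ p.1 p.2)).comp (ih.prodMk (measurable_pi_lambda _ fun c =>
        h.measurable_increments σ b δ k c))

lemma IsHarrisSystem.indepFun_walk {L : ℕ} (h : IsHarrisSystem P lam lam0 N) (σ : ℤˣ)
    (b : ℤ) (δ : ℝ≥0) (k : ℕ) :
    IndepFun (fun ω => walk σ (fun k => increments (L := L) N σ b δ k ω) k)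
      (increments (L := L) N σ b δ k) P := by
  classical
  set S : Finset ((Kind × Fin L) × ℕ) := Finset.univ ×ˢ Finset.range k with hS
  set T : Finset ((Kind × Fin L) × ℕ) := Finset.univ ×ˢ {k} with hT
  have hST : Disjoint S T := by
    rw [Finset.disjoint_left]
    rintro ⟨c, j⟩ h1 h2
    simp only [hS, hT, Finset.mem_product, Finset.mem_univ, true_and, Finset.mem_range,
      Finset.mem_singleton] at h1 h2
    omega
  have h1 := (h.iIndepFun_increments (L := L) σ b δ).indepFun_finset S T hST
    fun p => h.measurable_increments σ b δ p.2 p.1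
  -- The default value `0` outside `S` is never read: the first `k` steps use only the increments
  -- with index below `k`.
  have h2 := h1.comp (φ := fun f : S → ℕ =>
      walk σ (fun j c => if hc : (c, j) ∈ S then f ⟨(c, j), hc⟩ else 0) k)
    (ψ := fun (f : T → ℕ) (c : Kind × Fin L) => f ⟨(c, k), by simp [hT]⟩)
    .of_discrete .of_discrete
  have e : (fun ω => walk σ (fun k => increments (L := L) N σ b δ k ω) k) =
      (fun f : S → ℕ => walk σ (fun j c => if hc : (c, j) ∈ S then f ⟨(c, j), hc⟩ else 0) k) ∘
        fun ω i => increments N σ b δ (i : (Kind × Fin L) × ℕ).2 ω (i : (Kind × Fin L) × ℕ).1 := by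
    funext ω
    refine walk_congr σ fun j hj => ?_
    funext c
    have : (c, j) ∈ S := by simp [hS, hj]
    simp [this]
  rw [e]
  exact h2

lemma IsHarrisSystem.lintegral_expSum_walk_le {l : ℕ} (h : IsHarrisSystem P lam lam0 N) (σ : ℤˣ)
    {b : ℤ} (hb : ∀ i : Fin (l + 1), b + i ≠ 0) {θ : ℝ} (hθ : 0 ≤ θ) (δ : ℝ≥0) (k : ℕ) :
    ∫⁻ ω, ENNReal.ofReal (expSum θ
        (walk σ (fun k => increments (L := l + 1) N σ b δ k ω) k)) ∂P ≤
      ENNReal.ofReal (stepFactor (∑ c : Kind × Fin (l + 1), (bulkRate lam c.1 : ℝ)) θ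
        (growth lam σ (l + 1) θ) δ) ^ k * (l + 1 : ℕ) := by
  have : IsProbabilityMeasure P := h.indep.isProbabilityMeasure
  induction k with
  | zero =>
    simp only [walk, expSum, Pi.zero_apply, Int.cast_zero, mul_zero, Real.exp_zero,
      Finset.sum_const, Finset.card_univ, Fintype.card_fin, nsmul_eq_mul, mul_one,
      ENNReal.ofReal_natCast, lintegral_const, measure_univ, pow_zero, one_mul, le_refl]
  | succ k ih =>
    set ρ := ENNReal.ofReal (stepFactor (∑ c : Kind × Fin (l + 1), (bulkRate lam c.1 : ℝ)) θ
        (growth lam σ (l + 1) θ) δ) with hρ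
    set X : Ω → Fin (l + 1) → ℤ := fun ω => walk σ (fun k => increments N σ b δ k ω) k with hX
    have hXm : Measurable X := h.measurable_walk σ b δ k
    have hDm : Measurable (increments (L := l + 1) N σ b δ k) :=
      measurable_pi_lambda _ fun c => h.measurable_increments σ b δ k c
    have hmap := (indepFun_iff_map_prod_eq_prod_map_map hXm.aemeasurable hDm.aemeasurable).1
      (h.indepFun_walk σ b δ k)
    rw [h.map_increments σ hb δ k] at hmap
    set F : (Fin (l + 1) → ℤ) × (Kind × Fin (l + 1) → ℕ) → ENNReal :=
      fun p => ENNReal.ofReal (expSum θ (wallStep σ p.1 p.2)) with hF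
    have hFm : Measurable F := .of_discrete
    calc ∫⁻ ω, ENNReal.ofReal (expSum θ
          (walk σ (fun k => increments (L := l + 1) N σ b δ k ω) (k + 1))) ∂P
        = ∫⁻ p, F p ∂(P.map fun ω => (X ω, increments (L := l + 1) N σ b δ k ω)) :=
          (lintegral_map hFm (hXm.prodMk hDm)).symm
      _ = ∫⁻ g, ∫⁻ m, F (g, m) ∂(Measure.pi fun c : Kind × Fin (l + 1) =>
            poissonMeasure (bulkRate lam c.1 * δ)) ∂(P.map X) := by
          rw [hmap, lintegral_prod _ hFm.aemeasurable]
      _ ≤ ∫⁻ g, ρ * ENNReal.ofReal (expSum θ g) ∂(P.map X) :=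
          lintegral_mono fun g => lintegral_expSum_wallStep_le lam σ hθ δ g
      _ = ρ * ∫⁻ ω, ENNReal.ofReal (expSum θ (X ω)) ∂P := by
          rw [lintegral_const_mul _ .of_discrete, lintegral_map .of_discrete hXm]
      _ ≤ ρ * (ρ ^ k * (l + 1 : ℕ)) := by gcongr
      _ = ρ ^ (k + 1) * (l + 1 : ℕ) := by ring

/-- With `θ` and then `δ` small, the means of `exp (-θ v k δ) * W_k` decay geometrically, where
`W_k` is the exponential functional after `k` steps. Their series is therefore almost surely finite,
which bounds all its terms at once; taking logarithms gives the linear bound. -/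
lemma IsHarrisSystem.ae_walk_le {l : ℕ} (h : IsHarrisSystem P lam lam0 N) (σ : ℤˣ)
    {b : ℤ} (hb : ∀ i : Fin (l + 1), b + i ≠ 0) {v : ℝ}
    (hv : (lam : ℝ) * (σ : ℤ) + 1 / (l + 1 : ℕ) < v) :
    ∃ δ : ℝ≥0, 0 < δ ∧ ∀ᵐ ω ∂P, ∃ C : ℝ, ∀ k i,
      (walk σ (fun k => increments (L := l + 1) N σ b δ k ω) k i : ℝ) ≤ v * (k * δ) + C := by
  obtain ⟨θ, hθ, hK⟩ := exists_growth_lt lam σ (l + 1) hv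
  obtain ⟨δ, hδ, hlt⟩ := exists_stepFactor_lt
    (∑ c : Kind × Fin (l + 1), (bulkRate lam c.1 : ℝ)) θ (growth lam σ (l + 1) θ) hK
  lift δ to ℝ≥0 using hδ.le
  refine ⟨δ, by exact_mod_cast hδ, ?_⟩
  set ρ := stepFactor (∑ c : Kind × Fin (l + 1), (bulkRate lam c.1 : ℝ)) θ
    (growth lam σ (l + 1) θ) δ with hρ
  set κ := ENNReal.ofReal (Real.exp (-(θ * v * δ))) with hκ
  set X : ℕ → Ω → Fin (l + 1) → ℤ := fun k ω => walk σ (fun k => increments N σ b δ k ω) k with hX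
  have hXm : ∀ k, Measurable (X k) := fun k => h.measurable_walk σ b δ k
  have hWm : ∀ k, Measurable fun ω => κ ^ k * ENNReal.ofReal (expSum θ (X k ω)) := fun k =>
    ((Measurable.of_discrete (f := fun g : Fin (l + 1) → ℤ =>
      ENNReal.ofReal (expSum θ g))).comp (hXm k)).const_mul _
  have hq : κ * ENNReal.ofReal ρ < 1 := by
    rw [hκ, ← ENNReal.ofReal_mul (Real.exp_pos _).le]
    exact ENNReal.ofReal_lt_one.2 hlt
  have hfin : ∫⁻ ω, ∑' k, κ ^ k * ENNReal.ofReal (expSum θ (X k ω)) ∂P ≠ ⊤ := by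
    rw [lintegral_tsum fun k => (hWm k).aemeasurable]
    have hb : ∀ k, ∫⁻ ω, κ ^ k * ENNReal.ofReal (expSum θ (X k ω)) ∂P ≤
        (κ * ENNReal.ofReal ρ) ^ k * (l + 1 : ℕ) := by
      intro k
      rw [lintegral_const_mul' _ _ (by simp [hκ])]
      rw [mul_pow, mul_assoc]
      gcongr
      exact h.lintegral_expSum_walk_le σ hb hθ.le δ k
    refine ne_top_of_le_ne_top ?_ (ENNReal.tsum_le_tsum hb)
    rw [ENNReal.tsum_mul_right, ENNReal.tsum_geometric]
    refine ENNReal.mul_ne_top ?_ (by simp)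
    rw [ENNReal.inv_ne_top]
    exact (tsub_pos_of_lt hq).ne'
  filter_upwards [ae_lt_top (Measurable.tsum hWm) hfin] with ω hω
  set S := ∑' k, κ ^ k * ENNReal.ofReal (expSum θ (X k ω)) with hS
  refine ⟨S.toReal / θ, fun k i => ?_⟩
  have h1 : κ ^ k * ENNReal.ofReal (expSum θ (X k ω)) ≤ S := ENNReal.le_tsum k
  have h2 : Real.exp (θ * X k ω i - θ * v * (k * δ)) ≤ S.toReal := by
    have h3 : ENNReal.ofReal (Real.exp (-(θ * v * δ)) ^ k * expSum θ (X k ω)) ≤ S := by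
      rwa [ENNReal.ofReal_mul (by positivity), ENNReal.ofReal_pow (Real.exp_pos _).le]
    rw [ENNReal.ofReal_le_iff_le_toReal hω.ne] at h3
    refine le_trans ?_ h3
    have h4 : Real.exp (θ * X k ω i) ≤ expSum θ (X k ω) :=
      Finset.single_le_sum (f := fun i => Real.exp (θ * X k ω i))
        (fun _ _ => (Real.exp_pos _).le) (Finset.mem_univ i)
    rw [← Real.exp_nat_mul]
    calc _ = Real.exp (k * -(θ * v * δ)) * Real.exp (θ * X k ω i) := by
          rw [← Real.exp_add]; ring_nf
      _ ≤ _ := by gcongr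
  have h5 := (Real.add_one_le_exp _).trans h2
  have h6 : (X k ω i : ℝ) - v * (k * δ) ≤ S.toReal / θ := by
    rw [le_div_iff₀ hθ]
    linarith
  linarith

end Chain

/-! ### Linear bounds for the heights -/

lemma exists_abs_sub_le {f : ℝ≥0 → ℕ} (hf : Monotone f) {r : ℝ≥0}
    (h : Tendsto (fun t : ℝ≥0 => (f t : ℝ) / t) atTop (𝓝 r)) {ε : ℝ} (hε : 0 < ε) :
    ∃ C, ∀ t : ℝ≥0, |(f t : ℝ) - r * t| ≤ ε * t + C := by
  have h1 := (Metric.tendsto_nhds.1 h ε hε).and (eventually_gt_atTop 0)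
  obtain ⟨T, hT⟩ := eventually_atTop.1 h1
  refine ⟨f T + r * T, fun t => ?_⟩
  rcases le_total T t with hTt | htT
  · obtain ⟨h2, h3⟩ := hT t hTt
    have h3' : (0 : ℝ) < t := by exact_mod_cast h3
    rw [Real.dist_eq] at h2
    have e : (f t : ℝ) - r * t = ((f t : ℝ) / t - r) * t := by field_simp
    rw [e, abs_mul, abs_of_pos h3']
    have : |(f t : ℝ) / t - r| * t ≤ ε * t := by gcongr
    have : (0 : ℝ) ≤ f T + r * T := by positivity
    linarith
  · have h2 : (f t : ℝ) ≤ f T := by exact_mod_cast hf htT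
    have h3 : (r : ℝ) * t ≤ r * T := by gcongr
    have h4 : (0 : ℝ) ≤ r * t := by positivity
    have h5 : (0 : ℝ) ≤ f t := by positivity
    have h6 : (0 : ℝ) ≤ ε * t := by positivity
    rw [abs_le]
    constructor <;> linarith

/-- Almost surely `σ h_t(e_x) ≤ v t + C` for all times, in all large boxes. -/
def LinearBound {Ω : Type*} [MeasurableSpace Ω] (P : Measure Ω) (N : Kind × ℤ → ℝ≥0 → Ω → ℕ)
    (σ : ℤˣ) (x : ℤ) (v : ℝ) : Prop :=
  ∀ᵐ ω ∂P, ∃ C : ℝ, ∃ n₀ : ℕ, ∀ n ≥ n₀, ∀ t : ℝ≥0,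
    (((σ : ℤ) * boxHeight (marks N ω) n t x : ℤ) : ℝ) ≤ v * t + C

section Bounds

variable {Ω : Type*} [MeasurableSpace Ω] {P : Measure Ω} {lam lam0 : ℝ≥0}
  {N : Kind × ℤ → ℝ≥0 → Ω → ℕ}

lemma IsHarrisSystem.linearBound (h : IsHarrisSystem P lam lam0 N) (σ : ℤˣ) {x : ℤ} (hx : x ≠ 0)
    {v : ℝ} (hv : (lam : ℝ) * (σ : ℤ) < v) : LinearBound P N σ x v := by
  -- The total loss is `11 * ε`: one for the speed of the wall system and two for each of the five
  -- kinds of marks between grid times.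
  set ε := (v - lam * (σ : ℤ)) / 20 with hε
  have hεpos : 0 < ε := by rw [hε]; linarith
  obtain ⟨l, hl, hlx⟩ : ∃ l : ℕ, 1 / ((l + 1 : ℕ) : ℝ) < ε ∧ x.natAbs ≤ l := by
    obtain ⟨m, hm⟩ := exists_nat_one_div_lt hεpos
    refine ⟨max m x.natAbs, lt_of_le_of_lt ?_ hm, le_max_right _ _⟩
    push_cast
    gcongr
    exact le_max_left _ _
  -- The block starts next to the defect, on the side of `x`, and is long enough to contain `x`.
  obtain ⟨b, hb0, i₀, hi₀, hbn⟩ : ∃ b : ℤ, (∀ i : Fin (l + 1), b + i ≠ 0) ∧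
      ∃ i₀ : Fin (l + 1), b + i₀ = x ∧ ∀ i : Fin (l + 1), |b + i| ≤ ((l + 1 : ℕ) : ℤ) := by
    rcases lt_or_gt_of_ne hx with hneg | hpos
    · refine ⟨-(l + 1 : ℕ), fun i => by omega, ⟨(x + (l + 1 : ℕ)).toNat, by omega⟩, ?_, ?_⟩
      · simp only
        omega
      · intro i
        rw [abs_le]
        omega
    · refine ⟨1, fun i => by omega, ⟨(x - 1).toNat, by omega⟩, ?_, ?_⟩
      · simp only
        omega
      · intro i
        rw [abs_le]
        omega
  obtain ⟨δ, hδ, hwalk⟩ := h.ae_walk_le (v := lam * (σ : ℤ) + ε) σ hb0 (by linarith)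
  unfold LinearBound
  filter_upwards [hwalk, h.ae_locallyFinite, h.ae_cnt_eq, h.ae_cnt_tendsto] with ω hω hM hcnt htend
  obtain ⟨C, hC⟩ := hω
  choose C' hC' using fun k => exists_abs_sub_le (hM.cnt_mono k x) (htend k x) hεpos
  set v' : ℝ := lam * (σ : ℤ) + ε with hv'
  refine ⟨C + |v'| * δ + ∑ k, (rate lam lam0 k x * δ + 2 * C' k), l + 1, fun n hn t => ?_⟩
  have hbn' : ∀ j : Fin (l + 1), |b + j| ≤ (n : ℤ) := fun j =>
    (hbn j).trans (by exact_mod_cast hn)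
  set k := ⌊t / δ⌋₊ with hk
  have hkt : (k : ℝ≥0) * δ ≤ t := by
    rw [← le_div_iff₀ hδ]
    exact Nat.floor_le zero_le
  have htk : (t : ℝ) ≤ k * δ + δ := by
    have h1 := (Nat.lt_floor_add_one (t / δ)).le
    rw [div_le_iff₀ hδ] at h1
    have h2 : (t : ℝ) ≤ ((k : ℝ≥0) + 1 : ℝ≥0) * δ := by exact_mod_cast h1
    push_cast at h2
    linarith
  have hkt' : (k : ℝ) * δ ≤ t := by exact_mod_cast hkt
  have h1 : (((σ : ℤ) * boxHeight (marks N ω) n (k * δ) x : ℤ) : ℝ) ≤ v' * (k * δ) + C := by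
    have h2 := boxHeight_le_walk hM σ hbn' δ k i₀
    have e : (fun k : ℕ => markCount (L := l + 1) (marks N ω) σ b (k * δ) ((k + 1 : ℕ) * δ)) =
        fun k => increments N σ b δ k ω := by
      funext k c
      simp only [markCount, increments, hcnt]
    rw [e, hi₀] at h2
    exact (Int.cast_le.2 h2).trans (hC k i₀)
  have h3 : (((σ : ℤ) * boxHeight (marks N ω) n t x : ℤ) : ℝ) ≤
      ((σ : ℤ) * boxHeight (marks N ω) n (k * δ) x : ℤ) +
        ∑ j, ((cnt (marks N ω j x) t : ℝ) - cnt (marks N ω j x) (k * δ)) := by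
    have h4 := hM.abs_sub_le (n := n) hkt (x := x) (hi₀ ▸ hbn' i₀)
    have h5 : (σ : ℤ) * boxHeight (marks N ω) n t x ≤
        (σ : ℤ) * boxHeight (marks N ω) n (k * δ) x +
          ∑ j, ((cnt (marks N ω j x) t : ℤ) - cnt (marks N ω j x) (k * δ)) := by
      have h6 := abs_le.1 h4
      rcases Int.units_eq_one_or σ with rfl | rfl
      · simp only [Units.val_one, one_mul]
        linarith
      · simp only [Units.val_neg, Units.val_one, neg_mul, one_mul]
        linarith
    exact_mod_cast h5
  have h7 : ∑ j, ((cnt (marks N ω j x) t : ℝ) - cnt (marks N ω j x) (k * δ)) ≤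
      ∑ j : Kind, (2 * ε * t + (rate lam lam0 j x * δ + 2 * C' j)) := by
    refine Finset.sum_le_sum fun j _ => ?_
    have a1 := abs_le.1 (hC' j t)
    have a2 := abs_le.1 (hC' j (k * δ))
    push_cast at a2
    have a3 : (rate lam lam0 j x : ℝ) * t ≤ rate lam lam0 j x * (k * δ + δ) := by gcongr
    have a4 : ε * (k * δ) ≤ ε * t := by gcongr
    linarith
  rw [Finset.sum_add_distrib, Finset.sum_const] at h7
  have hcard : (Finset.univ : Finset Kind).card = 5 := rfl
  rw [hcard, nsmul_eq_mul] at h7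
  have h8 : v' * (k * δ) ≤ v' * t + |v'| * δ := by
    have : v' * (k * δ - t) ≤ |v'| * δ := by
      calc v' * (k * δ - t) ≤ |v' * (k * δ - t)| := le_abs_self _
        _ = |v'| * |(k : ℝ) * δ - t| := abs_mul _ _
        _ ≤ |v'| * δ := by
          gcongr
          rw [abs_le]
          constructor <;> linarith
    linarith
  have h9 : v' * t + 10 * ε * t ≤ v * t := by
    have : v' + 10 * ε ≤ v := by rw [hv']; linarith
    have h10 := mul_le_mul_of_nonneg_right this t.2
    change (v' + 10 * ε) * (t : ℝ) ≤ v * t at h10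
    linarith
  push_cast at h7
  linarith

lemma IsHarrisSystem.ae_peakCount (h : IsHarrisSystem P lam lam0 N) (σ : ℤˣ) {ε : ℝ}
    (hε : 0 < ε) :
    ∀ᵐ ω ∂P, ∃ C : ℝ, ∀ t : ℝ≥0,
      |(peakCount (marks N ω) σ t : ℝ) - ((σ : ℤ) * (lam + lam0) - 1) * t| ≤ ε * t + C := by
  filter_upwards [h.ae_locallyFinite, h.ae_cnt_tendsto] with ω hM htend
  obtain ⟨C₁, h1⟩ := exists_abs_sub_le (hM.cnt_mono .nuc 0) (htend .nuc 0) (ε := ε / 3) (by linarith)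
  obtain ⟨C₂, h2⟩ := exists_abs_sub_le (hM.cnt_mono (sw σ .leftR) 0) (htend (sw σ .leftR) 0)
    (ε := ε / 3) (by linarith)
  obtain ⟨C₃, h3⟩ := exists_abs_sub_le (hM.cnt_mono (sw σ .rightL) 0) (htend (sw σ .rightL) 0)
    (ε := ε / 3) (by linarith)
  refine ⟨C₁ + C₂ + C₃, fun t => ?_⟩
  have a1 := abs_le.1 (h1 t)
  have a2 := abs_le.1 (h2 t)
  have a3 := abs_le.1 (h3 t)
  rw [rate_sw] at a2 a3
  simp only [rate, if_true] at a1 a2 a3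
  push_cast at a1 a2 a3
  unfold peakCount
  push_cast
  rw [abs_le]
  rcases Int.units_eq_one_or σ with rfl | rfl
  · simp only [Units.val_one, Int.cast_one, one_mul]
    constructor <;> linarith
  · simp only [Units.val_neg, Units.val_one, Int.cast_neg, Int.cast_one, neg_mul, one_mul]
    constructor <;> linarith

/-- Up to the time `s` of `boxHeight_zero_le` a neighbour's linear bound applies, and from `s` to
`t` the law of large numbers for `peakCount`. Both slopes lie below `v - 2 * ε`, and the `2 * ε`
absorbs the errors of `peakCount` at `s` and `t`. -/
lemma IsHarrisSystem.linearBound_zero (h : IsHarrisSystem P lam lam0 N) (σ : ℤˣ) {v : ℝ}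
    (hv : (lam : ℝ) * (σ : ℤ) < v) (hv' : (σ : ℤ) * ((lam : ℝ) + lam0) - 1 < v) :
    LinearBound P N σ 0 v := by
  obtain ⟨ε, hε, h1, h2⟩ : ∃ ε > 0, (lam : ℝ) * (σ : ℤ) < v - 2 * ε ∧
      (σ : ℤ) * ((lam : ℝ) + lam0) - 1 < v - 2 * ε := by
    refine ⟨min (v - lam * (σ : ℤ)) (v - ((σ : ℤ) * ((lam : ℝ) + lam0) - 1)) / 4, ?_, ?_, ?_⟩
    · have : 0 < min (v - lam * (σ : ℤ)) (v - ((σ : ℤ) * ((lam : ℝ) + lam0) - 1)) :=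
        lt_min (by linarith) (by linarith)
      linarith
    · have := min_le_left (v - lam * (σ : ℤ)) (v - ((σ : ℤ) * ((lam : ℝ) + lam0) - 1))
      linarith
    · have := min_le_right (v - lam * (σ : ℤ)) (v - ((σ : ℤ) * ((lam : ℝ) + lam0) - 1))
      linarith
  unfold LinearBound
  filter_upwards [h.linearBound σ one_ne_zero h1, h.linearBound σ (x := -1) (by norm_num) h1,
    h.ae_peakCount σ hε, h.ae_locallyFinite] with ω hr hl hp hM
  obtain ⟨C₁, n₁, hC₁⟩ := hr
  obtain ⟨C₂, n₂, hC₂⟩ := hl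
  obtain ⟨C₃, hC₃⟩ := hp
  refine ⟨max C₁ C₂ + 2 * C₃ + 8, max n₁ n₂, fun n hn t => ?_⟩
  obtain ⟨s, hst, hle⟩ := boxHeight_zero_le (n := n) hM σ t
  have hst' : (s : ℝ) ≤ t := by exact_mod_cast hst
  have hs0 : (0 : ℝ) ≤ s := s.2
  have b1 := hC₁ n ((le_max_left _ _).trans hn) s
  have b2 := hC₂ n ((le_max_right _ _).trans hn) s
  have b3 := abs_le.1 (hC₃ t)
  have b4 := abs_le.1 (hC₃ s)
  have hle' : (((σ : ℤ) * boxHeight (marks N ω) n t 0 : ℤ) : ℝ) ≤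
      max (((σ : ℤ) * boxHeight (marks N ω) n s 1 : ℤ) : ℝ)
        (((σ : ℤ) * boxHeight (marks N ω) n s (-1) : ℤ) : ℝ) +
        ((peakCount (marks N ω) σ t : ℝ) - peakCount (marks N ω) σ s) + 8 := by
    have := (Int.cast_le (R := ℝ)).2 hle
    rw [← Int.cast_max]
    exact_mod_cast this
  have b5 : max (((σ : ℤ) * boxHeight (marks N ω) n s 1 : ℤ) : ℝ)
        (((σ : ℤ) * boxHeight (marks N ω) n s (-1) : ℤ) : ℝ) ≤ (v - 2 * ε) * s + max C₁ C₂ := by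
    refine max_le ?_ ?_
    · linarith [le_max_left C₁ C₂]
    · linarith [le_max_right C₁ C₂]
  have b6 : ((σ : ℤ) * ((lam : ℝ) + lam0) - 1) * (t - s) ≤ (v - 2 * ε) * (t - s) := by
    gcongr
  have b7 : ε * s ≤ ε * t := by gcongr
  linarith

lemma IsHarrisSystem.linearBound_zero_below (h : IsHarrisSystem P lam lam0 N) {v : ℝ}
    (hv : 1 - ((lam : ℝ) + lam0) < v) : LinearBound P N (-1) 0 v := by
  unfold LinearBound
  filter_upwards [h.ae_peakCount 1 (ε := v - (1 - ((lam : ℝ) + lam0))) (by linarith),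
    h.ae_locallyFinite] with ω hp hM
  obtain ⟨C, hC⟩ := hp
  refine ⟨C, 0, fun n _ t => ?_⟩
  have h1 : (peakCount (marks N ω) 1 t : ℝ) ≤ boxHeight (marks N ω) n t 0 := by
    exact_mod_cast peakCount_le_boxHeight hM t
  have h2 := abs_le.1 (hC t)
  simp only [Units.val_one, Int.cast_one, one_mul] at h2
  simp only [Units.val_neg, Units.val_one, neg_mul, one_mul]
  push_cast
  linarith

/-! ### The speed -/

/-- Countably many slopes suffice. Since the linear bounds are uniform in `n` and `t`, the box in
which the height is read off may depend on `t`. -/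
lemma IsHarrisSystem.hasSpeed [IsProbabilityMeasure P] (h : IsHarrisSystem P lam lam0 N) {x : ℤ}
    {V : ℝ} (hup : ∀ v > V, LinearBound P N 1 x v) (hlow : ∀ v > -V, LinearBound P N (-1) x v) :
    HasSpeed P (height N x) V := by
  have h1 : ∀ᵐ ω ∂P, ∀ m : ℕ, ∃ C : ℝ, ∃ n₀ : ℕ, ∀ n ≥ n₀, ∀ t : ℝ≥0,
      ((((1 : ℤˣ) : ℤ) * boxHeight (marks N ω) n t x : ℤ) : ℝ) ≤ (V + 1 / (m + 1 : ℝ)) * t + C :=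
    ae_all_iff.2 fun m => hup _ (by have : (0 : ℝ) < 1 / (m + 1 : ℝ) := by positivity
                                    linarith)
  have h2 : ∀ᵐ ω ∂P, ∀ m : ℕ, ∃ C : ℝ, ∃ n₀ : ℕ, ∀ n ≥ n₀, ∀ t : ℝ≥0,
      ((((-1 : ℤˣ) : ℤ) * boxHeight (marks N ω) n t x : ℤ) : ℝ) ≤ (-V + 1 / (m + 1 : ℝ)) * t + C :=
    ae_all_iff.2 fun m => hlow _ (by have : (0 : ℝ) < 1 / (m + 1 : ℝ) := by positivity
                                     linarith)
  unfold HasSpeed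
  filter_upwards [h1, h2, h.ae_locallyFinite, h.ae_hasClearEdges] with ω h1 h2 hM hc
  rw [Metric.tendsto_nhds]
  intro ε hε
  obtain ⟨m, hm⟩ := exists_nat_one_div_lt (half_pos hε)
  obtain ⟨C₁, n₁, hC₁⟩ := h1 m
  obtain ⟨C₂, n₂, hC₂⟩ := h2 m
  have hbig : ∀ᶠ t : ℝ≥0 in atTop, max C₁ C₂ < ε / 2 * (t : ℝ) ∧ (0 : ℝ) < t := by
    have hco : Tendsto (fun t : ℝ≥0 => (t : ℝ)) atTop atTop :=
      NNReal.tendsto_coe_atTop.2 tendsto_id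
    exact ((hco.const_mul_atTop (half_pos hε)).eventually_gt_atTop _).and
      (hco.eventually_gt_atTop 0)
  filter_upwards [hbig] with t ht
  obtain ⟨hC, ht0⟩ := ht
  obtain ⟨n, hn, hn1, hn2⟩ := ((eventually_markHeight_eq hM (hc t) x).and
    ((eventually_ge_atTop n₁).and (eventually_ge_atTop n₂))).exists
  have e : height N x t ω = boxHeight (marks N ω) n t x := hn
  have b1 := hC₁ n hn1 t
  have b2 := hC₂ n hn2 t
  simp only [Units.val_neg, Units.val_one, neg_mul, one_mul] at b1 b2
  push_cast at b1 b2
  rw [← e] at b1 b2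
  have b3 : 1 / ((m : ℝ) + 1) * t ≤ ε / 2 * t := by gcongr
  have m1 := le_max_left C₁ C₂
  have m2 := le_max_right C₁ C₂
  rw [Real.dist_eq, abs_lt]
  have e2 : (height N x t ω : ℝ) / t - V = ((height N x t ω : ℝ) - V * t) / t := by field_simp
  rw [e2, lt_div_iff₀ ht0, div_lt_iff₀ ht0]
  constructor <;> linarith

lemma IsHarrisSystem.hasSpeed_of_ne_zero [IsProbabilityMeasure P]
    (h : IsHarrisSystem P lam lam0 N) {x : ℤ} (hx : x ≠ 0) : HasSpeed P (height N x) lam :=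
  h.hasSpeed (fun v hv => h.linearBound 1 hx (by simpa using hv))
    (fun v hv => h.linearBound (-1) hx (by simpa using hv))

lemma IsHarrisSystem.hasSpeed_zero [IsProbabilityMeasure P] (h : IsHarrisSystem P lam lam0 N) :
    HasSpeed P (height N 0) ((lam : ℝ) + max ((lam0 : ℝ) - 1) 0) := by
  refine h.hasSpeed (fun v hv => ?_) (fun v hv => ?_)
  · have h1 := le_max_left ((lam0 : ℝ) - 1) 0
    have h2 := le_max_right ((lam0 : ℝ) - 1) 0
    exact h.linearBound_zero 1 (by simp; linarith) (by simp; linarith)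
  -- For a weak defect the lower bound `λ` is inherited from the neighbours; for a strong one it
  -- comes from `peakCount` alone.
  · rcases le_total ((lam0 : ℝ) - 1) 0 with h0 | h0
    · rw [max_eq_right h0] at hv
      have h1 : (0 : ℝ) ≤ lam0 := lam0.2
      exact h.linearBound_zero (-1) (by simp; linarith) (by simp; linarith)
    · rw [max_eq_left h0] at hv
      exact h.linearBound_zero_below (by linarith)

lemma HasSpeed.unique [IsProbabilityMeasure P] {H : ℝ≥0 → Ω → ℤ} {v w : ℝ} (hv : HasSpeed P H v)
    (hw : HasSpeed P H w) : v = w := by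
  obtain ⟨ω, h1, h2⟩ := (hv.and hw).exists
  exact tendsto_nhds_unique h1 h2

end Bounds

end RPNG

end

theorem theorem1 (lam : ℝ≥0) :
    (∀ (lam0 : ℝ≥0) (Ω : Type*) [MeasurableSpace Ω] (P : Measure Ω) [IsProbabilityMeasure P]
        (N : RPNG.Kind × ℤ → ℝ≥0 → Ω → ℕ), RPNG.IsHarrisSystem P lam lam0 N →
        RPNG.HasSpeed P (RPNG.height N 0) ((lam : ℝ) + max ((lam0 : ℝ) - 1) 0) ∧
        ∀ x : ℤ, x ≠ 0 → RPNG.HasSpeed P (RPNG.height N x) (lam : ℝ)) ∧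
    (∀ (Ω : ℝ≥0 → Type*) [∀ lam0, MeasurableSpace (Ω lam0)] (P : ∀ lam0, Measure (Ω lam0))
        [∀ lam0, IsProbabilityMeasure (P lam0)]
        (N : ∀ lam0, RPNG.Kind × ℤ → ℝ≥0 → Ω lam0 → ℕ),
        (∀ lam0, RPNG.IsHarrisSystem (P lam0) lam lam0 (N lam0)) →
        RPNG.criticalStrength P (fun lam0 => RPNG.height (N lam0) 0) = 1) := by
  refine ⟨fun lam0 Ω _ P _ N h => ⟨h.hasSpeed_zero, fun x hx => h.hasSpeed_of_ne_zero hx⟩, ?_⟩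
  intro Ω _ P _ N h
  unfold RPNG.criticalStrength
  -- Almost sure limits are unique, so the explicit speeds decide membership: the set is an open
  -- half-line and the infimum is not attained.
  have hset : {lam0 | ∃ v₀ v : ℝ, RPNG.HasSpeed (P 0) (RPNG.height (N 0) 0) v₀ ∧
      RPNG.HasSpeed (P lam0) (RPNG.height (N lam0) 0) v ∧ v₀ < v} = Set.Ioi 1 := by
    ext lam0
    have h0 := (h 0).hasSpeed_zero
    have h1 := (h lam0).hasSpeed_zero
    simp only [NNReal.coe_zero, zero_sub, max_eq_right (by norm_num : (-1 : ℝ) ≤ 0),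
      add_zero] at h0
    constructor
    · rintro ⟨v₀, v, hv₀, hv, hlt⟩
      rw [hv₀.unique h0, hv.unique h1] at hlt
      have h2 : 0 < max ((lam0 : ℝ) - 1) 0 := by linarith
      have h3 : (1 : ℝ) < lam0 := by
        by_contra hle
        rw [max_eq_right (by linarith)] at h2
        exact h2.false
      exact_mod_cast h3
    · intro hlt
      have h3 : (1 : ℝ) < lam0 := by exact_mod_cast (Set.mem_Ioi.1 hlt)
      refine ⟨_, _, h0, h1, ?_⟩
      have := le_max_left ((lam0 : ℝ) - 1) 0
      linarith
  rw [hset]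
  exact csInf_Ioi
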